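/- Let $m\ge 2$, $d\ge 1$, and let $A$ be a primitive $m\times m$ matrix with entries in $\{0,1\}$, i.e. $A^p$ has only positive entries for some $p\ge 1$. Let $\Sigma_A=\{x=(x_k)_{k\ge1}\in\{1,\dots,m\}^{\mathbb N}: A_{x_k x_{k+1}}=1 \text{ for all } k\}$ with shift map $\sigma$, let $\Sigma_{A,n}$ be the set of words $J=j_1\cdots j_n$ over $\{1,\dots,m\}$ with $A_{j_kj_{k+1}}=1$ for $1\le k<n$, and let $[J]=\{x\in\Sigma_A : x_k=j_k,\ 1\le k\le n\}$. For a $d\times d$ matrix $B$ with non-negative entries let $\|B\|=\sum_{a,b}B_{a,b}$. Let $M$ be a function on $\Sigma_A$ with values in the $d\times d$ real matrices with non-negative entries such that (H1) there are matrices $M_1,\dots,M_m$ with $M(x)=M_i$ whenever $x_1=i$; (H2) there is an integer $r>0$ such that for all $i,j\in\{1,\dots,m\}$ every entry of $\sum_{k=1}^{r}\sum_{K} M_K$ is positive, where the inner sum is over all $K\in\Sigma_{A,k}$ with $iKj\in\Sigma_{A,k+2}$, and $M_K=M_{k_1}\cdots M_{k_n}$ for a word $K=k_1\cdots k_n$.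 For $q>0$ put $s_n(q)=\sum_{J\in\Sigma_{A,n}}\sup_{x\in[J]}\|M(x)M(\sigma x)\cdots M(\sigma^{n-1}x)\|^q$. Then for every $q>0$ one has $s_n(q)>0$ for all $n\ge1$, the limit $$P(q)=\lim_{n\to\infty}\frac1n\log s_n(q)=\lim_{n\to\infty}\frac1n\log\sum_{J\in\Sigma_{A,n}}\|M_J\|^q$$ exists as a real number (both limits exist and agree), and the pressure function $P$ is differentiable at every $q>0$. -/

import Mathlib

open Filter Topology

/-- The subshift of finite type `Σ_A`: one-sided sequences over `m` symbols all of whose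
transitions are allowed by the `0`-`1` matrix `A`. -/
def Subshift {m : ℕ} (A : Matrix (Fin m) (Fin m) ℤ) : Type :=
  {x : ℕ → Fin m // ∀ n, A (x n) (x (n + 1)) = 1}

/-- The shift map `σ` on `Σ_A`. -/
def Subshift.shift {m : ℕ} {A : Matrix (Fin m) (Fin m) ℤ} (x : Subshift A) : Subshift A :=
  ⟨fun n => x.1 (n + 1), fun n => x.2 (n + 1)⟩

/-- A finite word is admissible if each of its consecutive transitions is allowed by `A`. -/
def Admissible {m : ℕ} (A : Matrix (Fin m) (Fin m) ℤ) (J : List (Fin m)) : Prop :=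
  J.IsChain (fun a b => A a b = 1)

/-- `Σ_{A,n}`: the finite set of admissible words of length `n`. -/
noncomputable def admissibleWords {m : ℕ} (A : Matrix (Fin m) (Fin m) ℤ) (n : ℕ) :
    Finset (List (Fin m)) :=
  ((List.finite_length_eq (Fin m) n).subset
    (fun J (hJ : J.length = n ∧ Admissible A J) => hJ.1) :
      {J : List (Fin m) | J.length = n ∧ Admissible A J}.Finite).toFinset

theorem mem_admissibleWords {m : ℕ} {A : Matrix (Fin m) (Fin m) ℤ} {n : ℕ}
    {J : List (Fin m)} : J ∈ admissibleWords A n ↔ J.length = n ∧ Admissible A J := by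
  simp [admissibleWords]

/-- The cylinder `[J]`: the points of `Σ_A` that begin with the word `J`. -/
def cylinder {m : ℕ} (A : Matrix (Fin m) (Fin m) ℤ) (J : List (Fin m)) : Set (Subshift A) :=
  {x | ∀ k : Fin J.length, x.1 k = J.get k}

/-- The sum of the entries `𝟏ᵗ B 𝟏`, which is a norm on matrices with non-negative entries. -/
def entrySum {d : ℕ} (B : Matrix (Fin d) (Fin d) ℝ) : ℝ :=
  ∑ i, ∑ j, B i j

/-- The product `M(x) M(σ x) ⋯ M(σ^{n-1} x)`. -/
def orbitProd {m d : ℕ} {A : Matrix (Fin m) (Fin m) ℤ}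
    (M : Subshift A → Matrix (Fin d) (Fin d) ℝ) (n : ℕ) (x : Subshift A) :
    Matrix (Fin d) (Fin d) ℝ :=
  ((List.range n).map (fun k => M (Subshift.shift^[k] x))).prod

/-- The product `M_J = M_{j_1} ⋯ M_{j_n}` along the word `J = j_1 ⋯ j_n`. -/
def wordProd {m d : ℕ} (N : Fin m → Matrix (Fin d) (Fin d) ℝ) (J : List (Fin m)) :
    Matrix (Fin d) (Fin d) ℝ :=
  (J.map N).prod

/-- `∑_{J ∈ Σ_{A,n}} sup_{x ∈ [J]} ‖M(x) M(σ x) ⋯ M(σ^{n-1} x)‖^q`. -/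
noncomputable def partitionSum {m d : ℕ} {A : Matrix (Fin m) (Fin m) ℤ}
    (M : Subshift A → Matrix (Fin d) (Fin d) ℝ) (q : ℝ) (n : ℕ) : ℝ :=
  ∑ J ∈ admissibleWords A n, ⨆ x : cylinder A J, entrySum (orbitProd M n x) ^ q

/-- The pressure `P(q)` of `M`: the limit of `(1/n) log` of the partition sums. -/
noncomputable def pressure {m d : ℕ} {A : Matrix (Fin m) (Fin m) ℤ}
    (M : Subshift A → Matrix (Fin d) (Fin d) ℝ) (q : ℝ) : ℝ :=
  limUnder atTop (fun n : ℕ => (1 / (n : ℝ)) * Real.log (partitionSum M q n))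

open Classical in
/-- Irreducibility of the matrices `N_1, …, N_m` along `A`: there is `r > 0` such that for all
symbols `i, j` the sum of the products `N_K` over the words `K` of length `1, …, r` for which
`iKj` is admissible is a matrix with all entries positive. -/
def IrreducibleAlong {m d : ℕ} (A : Matrix (Fin m) (Fin m) ℤ)
    (N : Fin m → Matrix (Fin d) (Fin d) ℝ) : Prop :=
  ∃ r : ℕ, 0 < r ∧ ∀ i j : Fin m, ∀ a b : Fin d,
    0 < (∑ k ∈ Finset.Icc 1 r,
      ∑ K ∈ (admissibleWords A k).filter (fun K => Admissible A (i :: (K ++ [j]))),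
        wordProd N K) a b

/-! Put `φ J = ‖M_J‖` on admissible words and `0` elsewhere. It is submultiplicative, and (H2) gives
the reverse inequality up to a constant and a connecting word of bounded length
(`wordNorm_quasiMultiplicative`). The rest concerns such weights only. Fekete's lemma gives `P(q)`,
with total `q`-weights within bounded factors of `exp (n P(q))` (`exists_growth_rate`).

Fix `q`. Banach limits of the normalised weights `φ^q exp (-n P(q))` produce a shift-invariant
measure `μ` comparable to them on cylinders, a Gibbs measure (`exists_stationaryWeight`). By the
connecting words, two blocks of `μ` are, averaged over a short gap, partly independent
(`exists_mixing`). Hence the second moment `V n` of `log φ - n L`, with `L` the mean growth rate,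
gains a factor at most `4 - θ ^ 2` when the length roughly doubles, up to a negligible error
(`exists_sq_step`), and `V n / n ^ 2` tends to `0` along lengths of bounded ratio
(`exists_concentration`).

Now `exp (n (P(q + t) - P(q)))` is at most a constant times the `μ`-mean of `exp (t log φ)` at any
single length `n`. Taking `n` of order `1 / |t|` and using the concentration, `P(q + t) - P(q) ≤ t L
+ ε |t|` for small `t` of either sign (`exists_upper_slope`). Convexity (`two_mul_growth_rate_le`)
reflects this into the matching lower bound, so `P'(q) = L`. -/

/-- The finite set of all words of length `n` over a finite alphabet. -/
noncomputable def words (α : Type*) [Finite α] (n : ℕ) : Finset (List α) :=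
  (List.finite_length_eq α n).toFinset

/-! ### Quasi-multiplicative weights and their growth rate -/

section Words

variable {α : Type*}

/-- A non-negative weight on words that is submultiplicative under concatenation, and
supermultiplicative up to a constant and the insertion of a connecting word of bounded length. -/
structure QuasiMultiplicative (w : List α → ℝ) : Prop where
  nonneg : ∀ I, 0 ≤ w I
  append_le : ∀ I J, w (I ++ J) ≤ w I * w J
  gap : ∃ (r : ℕ) (c : ℝ), 0 < c ∧ ∀ I J, I ≠ [] → J ≠ [] →
    ∃ K : List α, K ≠ [] ∧ K.length ≤ r ∧ c * w I * w J ≤ w (I ++ (K ++ J))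
  exists_pos : ∃ I, I ≠ [] ∧ 0 < w I

theorem QuasiMultiplicative.exists_long {w : List α → ℝ} (hw : QuasiMultiplicative w) (n : ℕ) :
    ∃ I, I ≠ [] ∧ n ≤ I.length ∧ 0 < w I := by
  obtain ⟨r, c, hc, hgap⟩ := hw.gap
  induction n with
  | zero =>
    obtain ⟨I, h1, h2⟩ := hw.exists_pos
    exact ⟨I, h1, Nat.zero_le _, h2⟩
  | succ n ih =>
    obtain ⟨I, h1, h2, h3⟩ := ih
    obtain ⟨K, hK, -, h⟩ := hgap I I h1 h1
    refine ⟨I ++ (K ++ I), by simp [h1], ?_, lt_of_lt_of_le (by positivity) h⟩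
    have := List.length_pos_iff.2 hK
    simp only [List.length_append]
    omega

/-- Multiplying by an exponential of the length preserves quasi-multiplicativity. -/
theorem QuasiMultiplicative.mul_exp_length {w : List α → ℝ} (hw : QuasiMultiplicative w) (P : ℝ) :
    QuasiMultiplicative fun J => w J * Real.exp (-(J.length * P)) := by
  refine ⟨fun I => mul_nonneg (hw.nonneg I) (Real.exp_pos _).le, fun I J => ?_, ?_, ?_⟩
  · have : Real.exp (-((I ++ J).length * P)) =
        Real.exp (-(I.length * P)) * Real.exp (-(J.length * P)) := by
      rw [← Real.exp_add, List.length_append]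
      push_cast
      ring_nf
    rw [this]
    have := mul_le_mul_of_nonneg_right (hw.append_le I J)
      (mul_pos (Real.exp_pos (-(I.length * P))) (Real.exp_pos (-(J.length * P)))).le
    linarith
  · obtain ⟨r, c, hc, hgap⟩ := hw.gap
    refine ⟨r, c * Real.exp (-(r * |P|)), by positivity, fun I J hI hJ => ?_⟩
    obtain ⟨K, hK, hKr, h⟩ := hgap I J hI hJ
    refine ⟨K, hK, hKr, ?_⟩
    have h1 : Real.exp (-((I ++ (K ++ J)).length * P)) =
        Real.exp (-(I.length * P)) * Real.exp (-(J.length * P)) * Real.exp (-(K.length * P)) := by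
      rw [← Real.exp_add, ← Real.exp_add, List.length_append, List.length_append]
      push_cast
      ring_nf
    have h2 : Real.exp (-(r * |P|)) ≤ Real.exp (-(K.length * P)) := by
      have h3 : (K.length : ℝ) ≤ r := by exact_mod_cast hKr
      have : (K.length : ℝ) * P ≤ r * |P| :=
        (mul_le_mul_of_nonneg_left (le_abs_self P) (Nat.cast_nonneg _)).trans
          (mul_le_mul_of_nonneg_right h3 (abs_nonneg P))
      exact Real.exp_le_exp.2 (by linarith)
    rw [h1]
    have hwI := hw.nonneg I
    have hwJ := hw.nonneg J
    have hwK := hw.nonneg (I ++ (K ++ J))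
    calc c * Real.exp (-(r * |P|)) * (w I * Real.exp (-(I.length * P))) *
          (w J * Real.exp (-(J.length * P)))
        = (c * w I * w J) * (Real.exp (-(I.length * P)) * Real.exp (-(J.length * P)) *
          Real.exp (-(r * |P|))) := by ring
      _ ≤ w (I ++ (K ++ J)) * (Real.exp (-(I.length * P)) * Real.exp (-(J.length * P)) *
          Real.exp (-(K.length * P))) := by gcongr
  · obtain ⟨I, hI, h⟩ := hw.exists_pos
    exact ⟨I, hI, by positivity⟩

/-- Positive powers of a quasi-multiplicative weight are quasi-multiplicative. -/
theorem QuasiMultiplicative.rpow {w : List α → ℝ} (hw : QuasiMultiplicative w) {q : ℝ} (hq : 0 < q) :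
    QuasiMultiplicative fun J => w J ^ q := by
  refine ⟨fun I => Real.rpow_nonneg (hw.nonneg I) q, fun I J => ?_, ?_, ?_⟩
  · rw [← Real.mul_rpow (hw.nonneg I) (hw.nonneg J)]
    exact Real.rpow_le_rpow (hw.nonneg _) (hw.append_le I J) hq.le
  · obtain ⟨r, c, hc, hgap⟩ := hw.gap
    refine ⟨r, c ^ q, by positivity, fun I J hI hJ => ?_⟩
    obtain ⟨K, hK, hKr, h⟩ := hgap I J hI hJ
    refine ⟨K, hK, hKr, ?_⟩
    have hwI := hw.nonneg I
    have hwJ := hw.nonneg J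
    rw [← Real.mul_rpow hc.le hwI, ← Real.mul_rpow (by positivity) hwJ]
    exact Real.rpow_le_rpow (by positivity) h hq.le
  · obtain ⟨I, hI, h⟩ := hw.exists_pos
    exact ⟨I, hI, by positivity⟩

variable [Fintype α]

theorem mem_words {n : ℕ} {J : List α} : J ∈ words α n ↔ J.length = n := by
  simp [words]

theorem sum_words_zero (g : List α → ℝ) : ∑ J ∈ words α 0, g J = g [] := by
  have : words α 0 = {[]} := by
    ext J; simp [mem_words]
  simp [this]

theorem sum_words_one (g : List α → ℝ) : ∑ J ∈ words α 1, g J = ∑ a, g [a] := by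
  symm
  refine Finset.sum_bij (fun a _ => [a]) ?_ ?_ ?_ ?_
  · simp [mem_words]
  · simp
  · intro J hJ
    rw [mem_words, List.length_eq_one_iff] at hJ
    obtain ⟨a, rfl⟩ := hJ
    exact ⟨a, Finset.mem_univ _, rfl⟩
  · simp

theorem sum_words_add (n k : ℕ) (g : List α → ℝ) :
    ∑ J ∈ words α (n + k), g J = ∑ I ∈ words α n, ∑ J ∈ words α k, g (I ++ J) := by
  rw [← Finset.sum_product']
  refine Finset.sum_bij' (fun J _ => (J.take n, J.drop n)) (fun p _ => p.1 ++ p.2) ?_ ?_ ?_ ?_ ?_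
  · intro J hJ
    simp only [mem_words, Finset.mem_product, List.length_take, List.length_drop] at *
    omega
  · rintro ⟨I, J⟩ h
    simp only [mem_words, Finset.mem_product, List.length_append] at *
    omega
  · simp
  · rintro ⟨I, J⟩ h
    simp only [mem_words, Finset.mem_product] at h
    simp [← h.1]
  · simp

/-- The total weight of the words of length `n`. -/
noncomputable def totalWeight (w : List α → ℝ) (n : ℕ) : ℝ := ∑ J ∈ words α n, w J

namespace QuasiMultiplicative

variable {w : List α → ℝ}

theorem totalWeight_nonneg (hw : QuasiMultiplicative w) (n : ℕ) : 0 ≤ totalWeight w n :=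
  Finset.sum_nonneg fun J _ => hw.nonneg J

theorem le_totalWeight (hw : QuasiMultiplicative w) (J : List α) :
    w J ≤ totalWeight w J.length :=
  Finset.single_le_sum (f := w) (fun J _ => hw.nonneg J) (mem_words.2 rfl)

theorem totalWeight_add_le (hw : QuasiMultiplicative w) (n k : ℕ) :
    totalWeight w (n + k) ≤ totalWeight w n * totalWeight w k := by
  rw [totalWeight, sum_words_add, totalWeight, totalWeight, Finset.sum_mul_sum]
  exact Finset.sum_le_sum fun I _ => Finset.sum_le_sum fun J _ => hw.append_le I J

theorem totalWeight_pos (hw : QuasiMultiplicative w) (n : ℕ) : 0 < totalWeight w n := by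
  obtain ⟨I, -, h2, h3⟩ := hw.exists_long n
  have h4 := h3.trans_le (hw.le_totalWeight I)
  obtain ⟨k, hk⟩ := Nat.exists_eq_add_of_le h2
  rw [hk] at h4
  have h5 := h4.trans_le (hw.totalWeight_add_le n k)
  exact pos_of_mul_pos_left h5 (hw.totalWeight_nonneg k)

theorem one_le_nil (hw : QuasiMultiplicative w) : 1 ≤ w [] := by
  have h := hw.append_le [] []
  have h0 : 0 < w [] := by
    simpa [totalWeight, sum_words_zero] using hw.totalWeight_pos 0
  simp only [List.append_nil] at h
  nlinarith

/-- The mass of the extensions of a word by `j` letters to the right and to the left is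
comparable to the product of the weights. -/
theorem exists_extension_bound (hw : QuasiMultiplicative w) :
    ∃ c : ℝ, 0 < c ∧ ∀ U : List α, U ≠ [] → ∀ j : ℕ, j ≠ 0 →
      c * totalWeight w j * w U ≤ ∑ B ∈ words α j, w (U ++ B) ∧
      c * totalWeight w j * w U ≤ ∑ A ∈ words α j, w (A ++ U) := by
  obtain ⟨r, c, hc, hgap⟩ := hw.gap
  set D : ℝ := ∑ k ∈ Finset.range (r + 1), totalWeight w k with hD
  have hDpos : 0 < D := Finset.sum_pos (fun k _ => hw.totalWeight_pos k) (by simp)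
  have key : ∀ U V : List α, U ≠ [] → V ≠ [] →
      c * w U * w V ≤ ∑ k ∈ Finset.range (r + 1), ∑ K ∈ words α k, w (U ++ (K ++ V)) := by
    intro U V hU hV
    obtain ⟨K, -, hK, h⟩ := hgap U V hU hV
    refine h.trans ?_
    refine le_trans ?_ (Finset.single_le_sum
      (f := fun k => ∑ K ∈ words α k, w (U ++ (K ++ V)))
      (fun k _ => Finset.sum_nonneg fun _ _ => hw.nonneg _)
      (Finset.mem_range.2 (Nat.lt_succ_of_le hK)))
    exact Finset.single_le_sum (f := fun K => w (U ++ (K ++ V)))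
      (fun _ _ => hw.nonneg _) (mem_words.2 rfl)
  have hne : ∀ j ≠ 0, ∀ V ∈ words α j, V ≠ [] := by
    rintro j hj V hV rfl
    exact hj (by simpa using (mem_words.1 hV).symm)
  refine ⟨c / D, by positivity, fun U hU j hj => ⟨?_, ?_⟩⟩
  · have h1 : c * w U * totalWeight w j ≤ D * ∑ B ∈ words α j, w (U ++ B) := by
      calc c * w U * totalWeight w j
          = ∑ V ∈ words α j, c * w U * w V := by rw [totalWeight, Finset.mul_sum]
        _ ≤ ∑ V ∈ words α j, ∑ k ∈ Finset.range (r + 1), ∑ K ∈ words α k, w (U ++ (K ++ V)) :=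
            Finset.sum_le_sum fun V hV => key U V hU (hne j hj V hV)
        -- Regroup `K ++ V` as `j` letters followed by `k`; submultiplicativity then splits off the
        -- last `k` letters, at total cost `D`.
        _ = ∑ k ∈ Finset.range (r + 1), ∑ B ∈ words α (j + k), w (U ++ B) := by
            rw [Finset.sum_comm]
            refine Finset.sum_congr rfl fun k _ => ?_
            rw [Finset.sum_comm, add_comm, sum_words_add]
        _ ≤ ∑ k ∈ Finset.range (r + 1), totalWeight w k * ∑ B ∈ words α j, w (U ++ B) := by
            refine Finset.sum_le_sum fun k _ => ?_
            rw [sum_words_add, mul_comm, totalWeight, Finset.sum_mul_sum]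
            refine Finset.sum_le_sum fun B _ => Finset.sum_le_sum fun K _ => ?_
            rw [← List.append_assoc]
            exact hw.append_le _ _
        _ = _ := by rw [hD, Finset.sum_mul]
    rw [div_mul_eq_mul_div, div_mul_eq_mul_div, div_le_iff₀ hDpos]
    linarith
  · have h1 : c * w U * totalWeight w j ≤ D * ∑ A ∈ words α j, w (A ++ U) := by
      calc c * w U * totalWeight w j
          = ∑ V ∈ words α j, c * w V * w U := by
            rw [totalWeight, Finset.mul_sum]
            exact Finset.sum_congr rfl fun _ _ => by ring
        _ ≤ ∑ V ∈ words α j, ∑ k ∈ Finset.range (r + 1), ∑ K ∈ words α k, w (V ++ (K ++ U)) :=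
            Finset.sum_le_sum fun V hV => key V U (hne j hj V hV) hU
        _ = ∑ k ∈ Finset.range (r + 1), ∑ A ∈ words α (k + j), w (A ++ U) := by
            rw [Finset.sum_comm]
            refine Finset.sum_congr rfl fun k _ => ?_
            rw [add_comm, sum_words_add]
            simp only [List.append_assoc]
        _ ≤ ∑ k ∈ Finset.range (r + 1), totalWeight w k * ∑ A ∈ words α j, w (A ++ U) := by
            refine Finset.sum_le_sum fun k _ => ?_
            rw [sum_words_add, totalWeight, Finset.sum_mul_sum]
            refine Finset.sum_le_sum fun B _ => Finset.sum_le_sum fun K _ => ?_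
            rw [List.append_assoc]
            exact hw.append_le _ _
        _ = _ := by rw [hD, Finset.sum_mul]
    rw [div_mul_eq_mul_div, div_mul_eq_mul_div, div_le_iff₀ hDpos]
    linarith

theorem exists_totalWeight_add_ge (hw : QuasiMultiplicative w) :
    ∃ c : ℝ, 0 < c ∧ ∀ n k : ℕ, n ≠ 0 → k ≠ 0 →
      c * totalWeight w n * totalWeight w k ≤ totalWeight w (n + k) := by
  obtain ⟨c, hc, h⟩ := hw.exists_extension_bound
  refine ⟨c, hc, fun n k hn hk => ?_⟩
  have h1 : totalWeight w (n + k) = ∑ U ∈ words α n, ∑ B ∈ words α k, w (U ++ B) :=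
    sum_words_add n k w
  have h2 : c * totalWeight w n * totalWeight w k =
      ∑ U ∈ words α n, c * totalWeight w k * w U := by
    rw [← Finset.mul_sum, totalWeight, totalWeight]
    ring
  rw [h1, h2]
  refine Finset.sum_le_sum fun U hU => (h U ?_ k hk).1
  rintro rfl
  exact hn (by simpa using (mem_words.1 hU).symm)

/-- The exponential growth rate of the total weights exists, and describes them up to a
bounded factor. -/
theorem exists_growth_rate (hw : QuasiMultiplicative w) {κ : ℝ} (hκ0 : 0 ≤ κ)
    (hκ : ∀ J, w J ≠ 0 → -(κ * (J.length + 1)) ≤ Real.log (w J)) :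
    ∃ P : ℝ, Tendsto (fun n : ℕ => (1 / (n : ℝ)) * Real.log (totalWeight w n)) atTop (𝓝 P) ∧
      (∀ n : ℕ, Real.exp (n * P) ≤ totalWeight w n) ∧
      ∃ C : ℝ, ∀ n : ℕ, totalWeight w n ≤ C * Real.exp (n * P) := by
  set u : ℕ → ℝ := fun n => Real.log (totalWeight w n) with hu
  have hsub : Subadditive u := by
    intro n k
    rw [hu, ← Real.log_mul (hw.totalWeight_pos n).ne' (hw.totalWeight_pos k).ne']
    exact Real.log_le_log (hw.totalWeight_pos _) (hw.totalWeight_add_le n k)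
  have hbdd : BddBelow (Set.range fun n => u n / n) := by
    refine ⟨-(2 * κ), ?_⟩
    rintro _ ⟨n, rfl⟩
    rcases Nat.eq_zero_or_pos n with rfl | hn
    · simpa using hκ0
    obtain ⟨J, hJ, hJ0⟩ := Finset.exists_ne_zero_of_sum_ne_zero (hw.totalWeight_pos n).ne'
    rw [mem_words] at hJ
    have h1 := hκ J hJ0
    have h2 : Real.log (w J) ≤ u n := by
      have := hw.le_totalWeight J
      rw [hJ] at this
      exact Real.log_le_log (lt_of_le_of_ne (hw.nonneg J) (Ne.symm hJ0)) this
    have hn1 : (1 : ℝ) ≤ n := by exact_mod_cast hn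
    rw [hJ] at h1
    change _ ≤ u n / n
    rw [le_div_iff₀ (by linarith)]
    nlinarith
  have hlim := hsub.tendsto_lim hbdd
  refine ⟨hsub.lim, by simpa [div_eq_inv_mul] using hlim, fun n => ?_, ?_⟩
  · rw [← Real.le_log_iff_exp_le (hw.totalWeight_pos n)]
    rcases Nat.eq_zero_or_pos n with rfl | hn
    · simpa [totalWeight, sum_words_zero] using Real.log_nonneg hw.one_le_nil
    · have := hsub.lim_le_div hbdd hn.ne'
      rwa [le_div_iff₀ (by exact_mod_cast hn), mul_comm] at this
  · obtain ⟨c, hc, hge⟩ := hw.exists_totalWeight_add_ge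
    -- The totals are also supermultiplicative up to `c`, so `-(log c + u)` is subadditive and
    -- Fekete bounds `u` from above. The value at `0` is set by hand because `hge` needs positive
    -- lengths.
    set v : ℕ → ℝ := fun n => if n = 0 then 0 else -(Real.log c + u n) with hv
    have hv0 : ∀ n ≠ 0, v n = -(Real.log c + u n) := fun n hn => by simp [hv, hn]
    have hvsub : Subadditive v := by
      intro n k
      rcases eq_or_ne n 0 with rfl | hn
      · simp [hv]
      rcases eq_or_ne k 0 with rfl | hk
      · simp [hv]
      rw [hv0 _ hn, hv0 _ hk, hv0 _ (by omega)]
      have h1 := hw.totalWeight_pos n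
      have h2 := hw.totalWeight_pos k
      have h := Real.log_le_log (by positivity) (hge n k hn hk)
      rw [Real.log_mul (by positivity) h2.ne', Real.log_mul hc.ne' h1.ne'] at h
      change Real.log c + u n + u k ≤ u (n + k) at h
      linarith
    have hvlim : Tendsto (fun n => v n / n) atTop (𝓝 (-hsub.lim)) := by
      have h1 : Tendsto (fun n : ℕ => -(Real.log c / n + u n / n)) atTop
          (𝓝 (-(0 + hsub.lim))) :=
        ((tendsto_const_div_atTop_nhds_zero_nat _).add hlim).neg
      rw [zero_add] at h1
      refine h1.congr' ?_
      filter_upwards [eventually_ne_atTop 0] with n hn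
      rw [hv0 n hn]
      ring
    have hvb : BddBelow (Set.range fun n => v n / n) := hvlim.bddBelow_range
    have hveq : hvsub.lim = -hsub.lim := tendsto_nhds_unique (hvsub.tendsto_lim hvb) hvlim
    refine ⟨max (w []) c⁻¹, fun n => ?_⟩
    rcases eq_or_ne n 0 with rfl | hn
    · simp [totalWeight, sum_words_zero]
    · have h1 := hvsub.lim_le_div hvb hn
      rw [hveq, hv0 n hn, le_div_iff₀ (by exact_mod_cast Nat.pos_of_ne_zero hn)] at h1
      have h2 : u n ≤ -Real.log c + n * hsub.lim := by linarith
      have h3 : totalWeight w n ≤ Real.exp (-Real.log c + n * hsub.lim) :=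
        (Real.log_le_iff_le_exp (hw.totalWeight_pos n)).1 h2
      rw [Real.exp_add, Real.exp_neg, Real.exp_log hc] at h3
      exact h3.trans (by gcongr; exact le_max_right _ _)

theorem totalWeight_mul_exp_length (w : List α → ℝ) (P : ℝ) (n : ℕ) :
    totalWeight (fun J => w J * Real.exp (-(J.length * P))) n =
      totalWeight w n * Real.exp (-(n * P)) := by
  rw [totalWeight, totalWeight, Finset.sum_mul]
  refine Finset.sum_congr rfl fun J hJ => ?_
  rw [mem_words.1 hJ]

end QuasiMultiplicative

end Words

/-! ### Banach limits -/

/-- A Banach limit: the limit of the Cesàro averages along a non-principal ultrafilter. -/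
noncomputable def banachLimit (u : ℕ → ℝ) : ℝ :=
  limUnder (hyperfilter ℕ : Filter ℕ) fun n : ℕ => (∑ i ∈ Finset.range n, u i) / n

theorem tendsto_banachLimit {u : ℕ → ℝ} {a b : ℝ} (hu : ∀ n, u n ∈ Set.Icc a b) :
    Tendsto (fun n : ℕ => (∑ i ∈ Finset.range n, u i) / n) (hyperfilter ℕ)
      (𝓝 (banachLimit u)) ∧ banachLimit u ∈ Set.Icc a b := by
  have hmem : ∀ᶠ n in (hyperfilter ℕ : Filter ℕ),
      (∑ i ∈ Finset.range n, u i) / n ∈ Set.Icc a b := by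
    have : ∀ᶠ n : ℕ in atTop, (∑ i ∈ Finset.range n, u i) / n ∈ Set.Icc a b := by
      filter_upwards [eventually_gt_atTop 0] with n hn
      have hn' : (0 : ℝ) < n := by exact_mod_cast hn
      rw [Set.mem_Icc, le_div_iff₀ hn', div_le_iff₀ hn']
      constructor
      · have := Finset.card_nsmul_le_sum (Finset.range n) u a fun i _ => (hu i).1
        simpa [mul_comm] using this
      · have := Finset.sum_le_card_nsmul (Finset.range n) u b fun i _ => (hu i).2
        simpa [mul_comm] using this
    exact Nat.hyperfilter_le_atTop this
  obtain ⟨x, hx, hle⟩ := isCompact_Icc.ultrafilter_le_nhds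
    ((hyperfilter ℕ).map fun n : ℕ => (∑ i ∈ Finset.range n, u i) / n)
    (le_principal_iff.2 hmem)
  have ht : Tendsto (fun n : ℕ => (∑ i ∈ Finset.range n, u i) / n) (hyperfilter ℕ) (𝓝 x) := hle
  have : banachLimit u = x := ht.limUnder_eq
  rw [this]
  exact ⟨ht, hx⟩

theorem banachLimit_mem_Icc {u : ℕ → ℝ} {a b : ℝ} (hu : ∀ n, u n ∈ Set.Icc a b) :
    banachLimit u ∈ Set.Icc a b :=
  (tendsto_banachLimit hu).2

/-- The Cesàro averages of `u` and of its shift differ by `(u n - u 0) / n`. The averaging is what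
makes the limit invariant; an ultrafilter limit of `u` itself need not be. -/
theorem banachLimit_shift {u : ℕ → ℝ} {a b : ℝ} (hu : ∀ n, u n ∈ Set.Icc a b) :
    banachLimit (fun n => u (n + 1)) = banachLimit u := by
  have h1 := (tendsto_banachLimit hu).1
  have h2 := (tendsto_banachLimit fun n => hu (n + 1)).1
  have h3 : Tendsto (fun n : ℕ => (u n - u 0) / n) (hyperfilter ℕ) (𝓝 0) := by
    refine Tendsto.mono_left ?_ Nat.hyperfilter_le_atTop
    refine squeeze_zero_norm (a := fun n : ℕ => (b - a) / n) (fun n => ?_)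
      (tendsto_const_div_atTop_nhds_zero_nat _)
    rw [norm_div, Real.norm_natCast]
    gcongr
    rw [Real.norm_eq_abs, abs_le]
    constructor <;> linarith [(hu n).1, (hu n).2, (hu 0).1, (hu 0).2]
  have h4 := h1.add h3
  rw [add_zero] at h4
  refine tendsto_nhds_unique h2 (h4.congr fun n => ?_)
  have := Finset.sum_range_succ' u n
  rw [Finset.sum_range_succ] at this
  rw [← add_div]
  congr 1
  linarith

theorem banachLimit_sum {ι : Type*} (s : Finset ι) {u : ι → ℕ → ℝ} {a b : ℝ}
    (hu : ∀ i n, u i n ∈ Set.Icc a b) :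
    banachLimit (fun n => ∑ i ∈ s, u i n) = ∑ i ∈ s, banachLimit (u i) := by
  have h1 := tendsto_finsetSum s fun i _ => (tendsto_banachLimit (hu i)).1
  refine Tendsto.limUnder_eq (h1.congr fun n => ?_)
  rw [Finset.sum_comm, Finset.sum_div]

/-! ### An invariant Gibbs measure -/

section Stationary

variable {α : Type*} [Fintype α]

/-- The cylinder masses of a shift-invariant probability measure on sequences. -/
structure StationaryWeight (μ : List α → ℝ) : Prop where
  nonneg : ∀ I, 0 ≤ μ I
  nil : μ [] = 1
  sum_cons : ∀ I, ∑ a, μ (a :: I) = μ I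
  sum_concat : ∀ I, ∑ a, μ (I ++ [a]) = μ I

/-- A quasi-multiplicative weight of bounded total weights is equivalent to a stationary one. -/
theorem QuasiMultiplicative.exists_stationaryWeight {w : List α → ℝ} (hw : QuasiMultiplicative w)
    {C : ℝ} (h1 : ∀ n, 1 ≤ totalWeight w n) (hC : ∀ n, totalWeight w n ≤ C) :
    ∃ μ : List α → ℝ, StationaryWeight μ ∧ ∃ D : ℝ, 0 < D ∧ ∀ I, I ≠ [] →
      w I ≤ D * μ I ∧ μ I ≤ D * w I := by
  obtain ⟨c', hc', hext'⟩ := hw.exists_extension_bound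
  have hC1 : 1 ≤ C := (h1 0).trans (hC 0)
  -- The minimum with `1` covers `j = 0`, where the extension sum is `w U` itself.
  set c := min c' 1 with hcdef
  have hc : 0 < c := lt_min hc' one_pos
  have hext : ∀ U : List α, U ≠ [] → ∀ j : ℕ,
      c * w U ≤ ∑ B ∈ words α j, w (U ++ B) ∧ c * w U ≤ ∑ A ∈ words α j, w (A ++ U) := by
    intro U hU j
    have hwU := hw.nonneg U
    rcases eq_or_ne j 0 with rfl | hj
    · have : c * w U ≤ 1 * w U := mul_le_mul_of_nonneg_right (min_le_right _ _) hwU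
      simpa [sum_words_zero] using this
    · have : c * w U ≤ c' * totalWeight w j * w U := by
        refine mul_le_mul_of_nonneg_right ?_ hwU
        exact (min_le_left _ _).trans (le_mul_of_one_le_right hc'.le (h1 j))
      exact ⟨this.trans (hext' U hU j hj).1, this.trans (hext' U hU j hj).2⟩
  -- Mass of the extensions of `I` by `i` letters on the left and `j` on the right. Summing over a
  -- new letter at either end only raises `i` or `j` by one, which a Banach limit does not see.
  set ρ : List α → ℕ → ℕ → ℝ :=
    fun I i j => ∑ A ∈ words α i, ∑ B ∈ words α j, w (A ++ I ++ B) with hρ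
  have hρ0 : ∀ I i j, 0 ≤ ρ I i j := fun I i j =>
    Finset.sum_nonneg fun _ _ => Finset.sum_nonneg fun _ _ => hw.nonneg _
  have hρu : ∀ I i j, ρ I i j ≤ C ^ 2 * w I := by
    intro I i j
    calc ρ I i j ≤ ∑ A ∈ words α i, ∑ B ∈ words α j, w A * w I * w B := by
          refine Finset.sum_le_sum fun A _ => Finset.sum_le_sum fun B _ => ?_
          exact (hw.append_le _ _).trans
            (mul_le_mul_of_nonneg_right (hw.append_le _ _) (hw.nonneg _))
      _ = totalWeight w i * totalWeight w j * w I := by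
          simp_rw [← Finset.mul_sum, ← Finset.sum_mul, totalWeight]
          ring
      _ ≤ C ^ 2 * w I := by
          refine mul_le_mul_of_nonneg_right ?_ (hw.nonneg _)
          rw [sq]
          exact mul_le_mul (hC i) (hC j) (hw.totalWeight_nonneg _) (by linarith)
  have hρl : ∀ I, I ≠ [] → ∀ i j, c ^ 2 * w I ≤ ρ I i j := by
    intro I hI i j
    calc c ^ 2 * w I = c * (c * w I) := by ring
      _ ≤ c * ∑ A ∈ words α i, w (A ++ I) := by gcongr; exact (hext I hI i).2
      _ = ∑ A ∈ words α i, c * w (A ++ I) := Finset.mul_sum _ _ _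
      _ ≤ ρ I i j := Finset.sum_le_sum fun A _ => (hext (A ++ I) (by simp [hI]) j).1
  have hρnil : ∀ i j, ρ [] i j = totalWeight w (i + j) := by
    intro i j
    simp only [hρ, totalWeight, sum_words_add, List.append_nil]
  have hcons : ∀ I i j, ∑ a, ρ (a :: I) i j = ρ I (i + 1) j := by
    intro I i j
    simp only [hρ, sum_words_add]
    rw [Finset.sum_comm]
    refine Finset.sum_congr rfl fun A _ => ?_
    rw [sum_words_one]
    simp
  have hconcat : ∀ I i j, ∑ a, ρ (I ++ [a]) i j = ρ I i (j + 1) := by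
    intro I i j
    simp only [hρ, add_comm j, sum_words_add]
    rw [Finset.sum_comm]
    refine Finset.sum_congr rfl fun A _ => ?_
    rw [sum_words_one]
    simp
  set ν : List α → ℝ := fun I => banachLimit fun i => banachLimit (ρ I i) with hν
  have hbd : ∀ I i j, ρ I i j ∈ Set.Icc 0 (C ^ 2 * w I) := fun I i j => ⟨hρ0 I i j, hρu I i j⟩
  have hbd' : ∀ I i, banachLimit (ρ I i) ∈ Set.Icc 0 (C ^ 2 * w I) := fun I i =>
    banachLimit_mem_Icc (hbd I i)
  -- One interval for all letters, as `banachLimit_sum` requires.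
  have hbdα : ∀ (f : α → List α) (a : α) i j,
      ρ (f a) i j ∈ Set.Icc 0 (∑ a, C ^ 2 * w (f a)) := fun f a i j =>
    ⟨hρ0 _ i j, (hρu _ i j).trans (Finset.single_le_sum (f := fun a => C ^ 2 * w (f a))
      (fun a _ => mul_nonneg (sq_nonneg C) (hw.nonneg _)) (Finset.mem_univ a))⟩
  have hνnil : 1 ≤ ν [] := by
    refine (banachLimit_mem_Icc (a := 1) (b := C ^ 2 * w []) fun i => ?_).1
    refine banachLimit_mem_Icc fun j => ⟨?_, hρu _ _ _⟩
    rw [hρnil]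
    exact h1 _
  have hνnil' : ν [] ≤ C := by
    refine (banachLimit_mem_Icc (a := 0) (b := C) fun i => ?_).2
    refine banachLimit_mem_Icc fun j => ⟨hρ0 _ _ _, ?_⟩
    rw [hρnil]
    exact hC _
  have hνpos : 0 < ν [] := by linarith
  have hsum : ∀ f : α → List α, ∑ a, ν (f a) =
      banachLimit fun i => banachLimit fun j => ∑ a, ρ (f a) i j := by
    intro f
    have h2 : ∀ i, (banachLimit fun j => ∑ a, ρ (f a) i j) = ∑ a, banachLimit (ρ (f a) i) :=
      fun i => banachLimit_sum _ fun a j => hbdα f a i j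
    simp_rw [h2]
    exact (banachLimit_sum _ fun a i => banachLimit_mem_Icc fun j => hbdα f a i j).symm
  have hν0 : ∀ I, 0 ≤ ν I := fun I => (banachLimit_mem_Icc (hbd' I)).1
  have hνu : ∀ I, ν I ≤ C ^ 2 * w I := fun I => (banachLimit_mem_Icc (hbd' I)).2
  have hνl : ∀ I, I ≠ [] → c ^ 2 * w I ≤ ν I := fun I hI =>
    (banachLimit_mem_Icc (b := C ^ 2 * w I) fun i =>
      banachLimit_mem_Icc fun j => ⟨hρl I hI i j, hρu _ _ _⟩).1
  have hνcons : ∀ I, ∑ a, ν (a :: I) = ν I := by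
    intro I
    rw [hsum]
    simp_rw [hcons]
    exact banachLimit_shift (u := fun i => banachLimit (ρ I i)) (hbd' I)
  have hνconcat : ∀ I, ∑ a, ν (I ++ [a]) = ν I := by
    intro I
    rw [hsum]
    simp_rw [hconcat]
    have : ∀ i, banachLimit (fun j => ρ I i (j + 1)) = banachLimit (ρ I i) :=
      fun i => banachLimit_shift (u := ρ I i) (hbd I i)
    simp_rw [this]
    rfl
  clear_value ν
  refine ⟨fun I => ν I / ν [], ⟨fun I => div_nonneg (hν0 I) hνpos.le, div_self hνpos.ne',
    fun I => ?_, fun I => ?_⟩, C / c ^ 2 + C ^ 2, by positivity, fun I hI => ⟨?_, ?_⟩⟩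
  · rw [← Finset.sum_div, hνcons]
  · rw [← Finset.sum_div, hνconcat]
  · have h0 := hν0 I
    calc w I ≤ ν I / c ^ 2 := by rw [le_div_iff₀ (by positivity)]; linarith [hνl I hI]
      _ = C / c ^ 2 * (ν I / C) := by field_simp
      _ ≤ (C / c ^ 2 + C ^ 2) * (ν I / ν []) := by
          gcongr
          exact le_add_of_nonneg_right (sq_nonneg C)
  · calc ν I / ν [] ≤ ν I := div_le_self (hν0 I) hνnil
      _ ≤ C ^ 2 * w I := hνu I
      _ ≤ _ := mul_le_mul_of_nonneg_right (le_add_of_nonneg_left (by positivity)) (hw.nonneg I)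

end Stationary

/-! ### Block statistics, mixing and the second-moment recursion -/

namespace StationaryWeight

variable {α : Type*} [Fintype α] {μ : List α → ℝ}

theorem sum_append_right (hμ : StationaryWeight μ) (I : List α) (n : ℕ) :
    ∑ B ∈ words α n, μ (I ++ B) = μ I := by
  induction n with
  | zero => simp [sum_words_zero]
  | succ n ih =>
    rw [sum_words_add, ← ih]
    refine Finset.sum_congr rfl fun B _ => ?_
    rw [sum_words_one, ← hμ.sum_concat (I ++ B)]
    simp

theorem sum_append_left (hμ : StationaryWeight μ) (I : List α) (n : ℕ) :
    ∑ A ∈ words α n, μ (A ++ I) = μ I := by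
  induction n with
  | zero => simp [sum_words_zero]
  | succ n ih =>
    rw [add_comm, sum_words_add, Finset.sum_comm, ← ih]
    refine Finset.sum_congr rfl fun B _ => ?_
    rw [sum_words_one, ← hμ.sum_cons (B ++ I)]
    simp

theorem sum_words (hμ : StationaryWeight μ) (n : ℕ) : ∑ J ∈ words α n, μ J = 1 := by
  simpa [hμ.nil] using hμ.sum_append_right [] n

/-- The expectation of a function of a block does not depend on the position of the block. -/
theorem sum_window (hμ : StationaryWeight μ) {N i n : ℕ} (h : i + n ≤ N) (g : List α → ℝ) :
    ∑ J ∈ words α N, μ J * g ((J.drop i).take n) = ∑ I ∈ words α n, μ I * g I := by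
  obtain ⟨j, rfl⟩ := Nat.exists_eq_add_of_le h
  rw [sum_words_add, sum_words_add]
  calc ∑ A ∈ words α i, ∑ I ∈ words α n, ∑ B ∈ words α j,
        μ (A ++ I ++ B) * g (((A ++ I ++ B).drop i).take n)
      = ∑ A ∈ words α i, ∑ I ∈ words α n, ∑ B ∈ words α j, μ (A ++ I ++ B) * g I := by
        refine Finset.sum_congr rfl fun A hA => Finset.sum_congr rfl fun I hI =>
          Finset.sum_congr rfl fun B _ => ?_
        rw [mem_words] at hA hI
        simp [← hA, ← hI]
    _ = ∑ A ∈ words α i, ∑ I ∈ words α n, μ (A ++ I) * g I := by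
        simp_rw [← Finset.sum_mul, hμ.sum_append_right]
    _ = _ := by
        rw [Finset.sum_comm]
        simp_rw [← Finset.sum_mul, hμ.sum_append_left]

/-- The joint expectation of a function of two blocks separated by a gap of length `k`. -/
theorem sum_two_windows (hμ : StationaryWeight μ) {N n k : ℕ} (h : n + k + n ≤ N)
    (g : List α → List α → ℝ) :
    ∑ J ∈ words α N, μ J * g (J.take n) ((J.drop (n + k)).take n) =
      ∑ I ∈ words α n, ∑ K ∈ words α k, ∑ J ∈ words α n, μ (I ++ (K ++ J)) * g I J := by
  obtain ⟨j, rfl⟩ := Nat.exists_eq_add_of_le h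
  rw [sum_words_add, sum_words_add, sum_words_add]
  refine Finset.sum_congr rfl fun I hI => Finset.sum_congr rfl fun K hK =>
    Finset.sum_congr rfl fun J hJ => ?_
  rw [mem_words] at hI hK hJ
  rw [← List.append_assoc, ← hμ.sum_append_right _ j, Finset.sum_mul]
  refine Finset.sum_congr rfl fun B _ => ?_
  congr 2
  · simp [← hI]
  · have : (I ++ (K ++ (J ++ B))).drop (n + k) = J ++ B := by
      simp [← hI, ← hK]
    simp only [List.append_assoc, this]
    simp [← hJ]

/-- Two blocks of a stationary weight equivalent to a quasi-multiplicative one are, on average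
over the gap between them, not too far from independent. -/
theorem exists_mixing (hμ : StationaryWeight μ) {w : List α → ℝ} (hw : QuasiMultiplicative w)
    {D : ℝ} (hD : 0 < D) (hwμ : ∀ I, I ≠ [] → w I ≤ D * μ I ∧ μ I ≤ D * w I) :
    ∃ (r : ℕ) (θ : ℝ), 0 < θ ∧ θ ≤ 1 ∧ 0 < r ∧ ∀ (n : ℕ), n ≠ 0 → ∀ g : List α → List α → ℝ,
      (∀ I J, 0 ≤ g I J) →
      θ * r * ∑ I ∈ words α n, ∑ J ∈ words α n, μ I * μ J * g I J ≤
        ∑ k ∈ Finset.range r, ∑ J ∈ words α (2 * n + r),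
          μ J * g (J.take n) ((J.drop (n + k)).take n) := by
  obtain ⟨r, c, hc, hgap⟩ := hw.gap
  have hr : (0 : ℝ) < ((r + 1 : ℕ) : ℝ) := by positivity
  refine ⟨r + 1, min 1 (c / D ^ 3 / (r + 1 : ℕ)), by positivity, min_le_left _ _, by omega,
    fun n hn g hg => ?_⟩
  have hne : ∀ V ∈ words α n, V ≠ [] := by
    rintro V hV rfl
    exact hn (by simpa using (mem_words.1 hV).symm)
  -- Two factors `D` come from `μ ≤ D w` on `I` and `J`, the third from `w ≤ D μ` on the joined
  -- word.
  have hpt : ∀ I ∈ words α n, ∀ J ∈ words α n, c / D ^ 3 * (μ I * μ J) ≤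
      ∑ k ∈ Finset.range (r + 1), ∑ K ∈ words α k, μ (I ++ (K ++ J)) := by
    intro I hI J hJ
    obtain ⟨K, -, hK, h⟩ := hgap I J (hne I hI) (hne J hJ)
    have h1 : c / D ^ 3 * (μ I * μ J) ≤ μ (I ++ (K ++ J)) := by
      have h2 := (hwμ I (hne I hI)).2
      have h3 := (hwμ J (hne J hJ)).2
      have h4 := (hwμ (I ++ (K ++ J)) (by simp [hne I hI])).1
      have h5 : μ I * μ J ≤ (D * w I) * (D * w J) :=
        mul_le_mul h2 h3 (hμ.nonneg _) (mul_nonneg hD.le (hw.nonneg _))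
      rw [div_mul_eq_mul_div, div_le_iff₀ (by positivity)]
      calc c * (μ I * μ J) ≤ c * ((D * w I) * (D * w J)) := by gcongr
        _ = D ^ 2 * (c * w I * w J) := by ring
        _ ≤ D ^ 2 * (D * μ (I ++ (K ++ J))) :=
            mul_le_mul_of_nonneg_left (h.trans h4) (sq_nonneg D)
        _ = _ := by ring
    refine h1.trans (le_trans ?_ (Finset.single_le_sum
      (f := fun k => ∑ K ∈ words α k, μ (I ++ (K ++ J)))
      (fun k _ => Finset.sum_nonneg fun _ _ => hμ.nonneg _)
      (Finset.mem_range.2 (Nat.lt_succ_of_le hK))))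
    exact Finset.single_le_sum (f := fun K => μ (I ++ (K ++ J)))
      (fun _ _ => hμ.nonneg _) (mem_words.2 rfl)
  have hθ : min 1 (c / D ^ 3 / (r + 1 : ℕ)) * (r + 1 : ℕ) ≤ c / D ^ 3 := by
    rw [← le_div_iff₀ hr]
    exact min_le_right _ _
  have hsum0 : 0 ≤ ∑ I ∈ words α n, ∑ J ∈ words α n, μ I * μ J * g I J :=
    Finset.sum_nonneg fun I _ => Finset.sum_nonneg fun J _ =>
      mul_nonneg (mul_nonneg (hμ.nonneg _) (hμ.nonneg _)) (hg I J)
  refine (mul_le_mul_of_nonneg_right hθ hsum0).trans ?_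
  rw [Finset.mul_sum]
  have hrw : ∀ k ∈ Finset.range (r + 1), ∑ J ∈ words α (2 * n + (r + 1)),
      μ J * g (J.take n) ((J.drop (n + k)).take n) =
      ∑ I ∈ words α n, ∑ J ∈ words α n, (∑ K ∈ words α k, μ (I ++ (K ++ J))) * g I J := by
    intro k hk
    rw [Finset.mem_range] at hk
    rw [hμ.sum_two_windows (by omega) g]
    refine Finset.sum_congr rfl fun I _ => ?_
    rw [Finset.sum_comm]
    simp_rw [Finset.sum_mul]
  rw [Finset.sum_congr rfl hrw, Finset.sum_comm]
  refine Finset.sum_le_sum fun I hI => ?_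
  rw [Finset.sum_comm, Finset.mul_sum]
  refine Finset.sum_le_sum fun J hJ => ?_
  rw [← Finset.sum_mul, ← mul_assoc]
  exact mul_le_mul_of_nonneg_right (hpt I hI J hJ) (hg I J)

end StationaryWeight

/-- Here `p`, `q` are the values on two blocks, `z` that on the long word, and `p + q + c - z` the
defect of subadditivity. Young's inequality with weight `θ / 2` separates `p + q` from the rest.
Only one factor of the squared defect is replaced by its crude bound, so that afterwards its first
moment suffices. -/
theorem sq_le_of_defect {p q z c b t θ : ℝ} (hθ : 0 < θ) (hc : |c| ≤ b)
    (hD0 : 0 ≤ p + q + c - z) (hDb : p + q + c - z ≤ b * t) :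
    z ^ 2 ≤ (1 + θ / 2) * (2 * p ^ 2 + 2 * q ^ 2 - (p - q) ^ 2) +
      (1 + 2 / θ) * (2 * b ^ 2 + 2 * b * t * (p + q + c - z)) := by
  have hcb : c ^ 2 ≤ b ^ 2 := sq_le_sq' (by linarith [neg_abs_le c]) ((le_abs_self c).trans hc)
  obtain ⟨D, hD⟩ : ∃ D, D = p + q + c - z := ⟨_, rfl⟩
  rw [← hD] at hD0 hDb ⊢
  have hDsq : (c - D) ^ 2 ≤ 2 * b ^ 2 + 2 * b * t * D := by
    linarith [sq_nonneg (c + D), mul_le_mul_of_nonneg_right hDb hD0]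
  have hzD : z = (p + q) + (c - D) := by rw [hD]; ring
  have hsq : z ^ 2 ≤ (1 + θ / 2) * (p + q) ^ 2 + (1 + 2 / θ) * (c - D) ^ 2 := by
    have : (1 + θ / 2) * (p + q) ^ 2 + (1 + 2 / θ) * (c - D) ^ 2 - z ^ 2 =
        (2 / θ) * ((θ / 2) * (p + q) - (c - D)) ^ 2 := by
      rw [hzD]
      field_simp
      ring
    have h0 : 0 ≤ (2 / θ) * ((θ / 2) * (p + q) - (c - D)) ^ 2 := by positivity
    linarith
  calc z ^ 2 ≤ (1 + θ / 2) * (p + q) ^ 2 + (1 + 2 / θ) * (c - D) ^ 2 := hsq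
    _ ≤ (1 + θ / 2) * (p + q) ^ 2 + (1 + 2 / θ) * (2 * b ^ 2 + 2 * b * t * D) := by gcongr
    _ = _ := by ring

namespace StationaryWeight

variable {α : Type*} [Fintype α] {μ : List α → ℝ}

theorem eq_zero_of_append (hμ : StationaryWeight μ) {A J : List α} (h : μ (A ++ J) ≠ 0) :
    μ J ≠ 0 := by
  intro h0
  refine h (le_antisymm ?_ (hμ.nonneg _))
  rw [← h0, ← hμ.sum_append_left J A.length]
  exact Finset.single_le_sum (f := fun A => μ (A ++ J)) (fun _ _ => hμ.nonneg _)
    (mem_words.2 rfl)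

/-- The averages of a subadditive function on words converge to their lower bound. -/
theorem exists_mean (hμ : StationaryWeight μ) {l : List α → ℝ} {κ : ℝ} (hκ0 : 0 ≤ κ)
    (hκ : ∀ I, |l I| ≤ κ * (I.length + 1))
    (hl : ∀ I J, μ (I ++ J) ≠ 0 → l (I ++ J) ≤ l I + l J) :
    ∃ L : ℝ, (∀ n, 0 ≤ ∑ I ∈ words α n, μ I * (l I - I.length * L)) ∧
      Tendsto (fun n : ℕ => (∑ I ∈ words α n, μ I * (l I - I.length * L)) / n) atTop (𝓝 0) := by
  set e : ℕ → ℝ := fun n => ∑ I ∈ words α n, μ I * l I with he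
  have hsub : Subadditive e := by
    intro n k
    calc e (n + k) ≤ ∑ J ∈ words α (n + k), (μ J * l ((J.drop 0).take n) +
          μ J * l ((J.drop n).take k)) := by
          refine Finset.sum_le_sum fun J hJ => ?_
          rw [mem_words] at hJ
          rw [← mul_add]
          rcases eq_or_ne (μ J) 0 with h0 | h0
          · simp [h0]
          · refine mul_le_mul_of_nonneg_left ?_ (hμ.nonneg J)
            have h1 : (J.drop n).take k = J.drop n := List.take_of_length_le (by simp [hJ])
            rw [h1, List.drop_zero]
            have := hl (J.take n) (J.drop n)
            rw [List.take_append_drop] at this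
            exact this h0
      _ = e n + e k := by
          rw [Finset.sum_add_distrib, hμ.sum_window (by omega), hμ.sum_window (by omega)]
  have hbdd : BddBelow (Set.range fun n => e n / n) := by
    refine ⟨-(2 * κ), ?_⟩
    rintro _ ⟨n, rfl⟩
    rcases Nat.eq_zero_or_pos n with rfl | hn
    · simpa using hκ0
    have hn1 : (1 : ℝ) ≤ n := by exact_mod_cast hn
    change _ ≤ e n / n
    rw [le_div_iff₀ (by linarith)]
    calc -(2 * κ) * n ≤ (∑ I ∈ words α n, μ I) * -(κ * (n + 1)) := by
          rw [hμ.sum_words]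
          nlinarith
      _ ≤ e n := by
          rw [Finset.sum_mul]
          refine Finset.sum_le_sum fun I hI => mul_le_mul_of_nonneg_left ?_ (hμ.nonneg I)
          have := (abs_le.1 (hκ I)).1
          rwa [mem_words.1 hI] at this
  have hval : ∀ L n, ∑ I ∈ words α n, μ I * (l I - I.length * L) = e n - n * L := by
    intro L n
    calc _ = ∑ I ∈ words α n, (μ I * l I - μ I * (n * L)) :=
          Finset.sum_congr rfl fun I hI => by rw [mem_words.1 hI]; ring
      _ = _ := by rw [Finset.sum_sub_distrib, ← Finset.sum_mul, hμ.sum_words, one_mul]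
  refine ⟨hsub.lim, fun n => ?_, ?_⟩
  -- The limit in Fekete's lemma is also the infimum of `e n / n` over positive `n`.
  · rw [hval, sub_nonneg]
    rcases Nat.eq_zero_or_pos n with rfl | hn
    · have h1 := hl [] [] (by simp [hμ.nil])
      simp only [List.append_nil] at h1
      simp only [he, sum_words_zero, hμ.nil, Nat.cast_zero]
      linarith
    · have := hsub.lim_le_div hbdd hn.ne'
      rwa [le_div_iff₀ (by exact_mod_cast hn), mul_comm] at this
  · have h1 : Tendsto (fun n : ℕ => e n / n - hsub.lim) atTop (𝓝 (hsub.lim - hsub.lim)) :=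
      (hsub.tendsto_lim hbdd).sub_const _
    rw [sub_self] at h1
    refine h1.congr' ?_
    filter_upwards [eventually_ne_atTop 0] with n hn
    have : (n : ℝ) ≠ 0 := by exact_mod_cast hn
    rw [hval]
    field_simp

/-- When the length of the words doubles, the second moment of the deviation of a subadditive
function from linear growth is multiplied by at most `4 - θ ^ 2`, up to a small error. -/
theorem exists_sq_step (hμ : StationaryWeight μ) {l : List α → ℝ} {κ : ℝ} (hκ0 : 0 ≤ κ)
    (hκ : ∀ I, |l I| ≤ κ * (I.length + 1))
    (hl : ∀ I J, μ (I ++ J) ≠ 0 → l (I ++ J) ≤ l I + l J) {L : ℝ}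
    (hL : ∀ n, 0 ≤ ∑ I ∈ words α n, μ I * (l I - I.length * L))
    {r : ℕ} (hr : 0 < r) {θ : ℝ} (hθ : 0 < θ) (hθ1 : θ ≤ 1)
    (hmix : ∀ (n : ℕ), n ≠ 0 → ∀ g : List α → List α → ℝ,
      (∀ I J, 0 ≤ g I J) →
      θ * r * ∑ I ∈ words α n, ∑ J ∈ words α n, μ I * μ J * g I J ≤
        ∑ k ∈ Finset.range r, ∑ J ∈ words α (2 * n + r),
          μ J * g (J.take n) ((J.drop (n + k)).take n)) :
    ∃ B : ℝ, ∀ n : ℕ, n ≠ 0 →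
      ∑ I ∈ words α (2 * n + r), μ I * (l I - I.length * L) ^ 2 ≤
        (4 - θ ^ 2) * ∑ I ∈ words α n, μ I * (l I - I.length * L) ^ 2 +
        B * n * (1 + ∑ I ∈ words α n, μ I * (l I - I.length * L)) := by
  set y : List α → ℝ := fun I => l I - I.length * L with hy
  -- Pays for the gap and the remainder, each of `l`-value at most `κ * (r + 1)`, and for centring
  -- `r` extra letters. The next constant `b` dominates `|c₁|`, and `b * n` dominates both the mean
  -- and the defect.
  set c₁ : ℝ := 2 * (κ * (r + 1)) - r * L with hc₁
  set b : ℝ := κ * (8 + r) + |L| * (4 + r) + |c₁| with hb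
  have hb0 : 0 ≤ b := by positivity
  have hyabs : ∀ I, |y I| ≤ κ * (I.length + 1) + I.length * |L| := by
    intro I
    calc |y I| ≤ |l I| + |I.length * L| := abs_sub _ _
      _ ≤ _ := by
        rw [abs_mul, Nat.abs_cast]
        linarith [hκ I]
  refine ⟨2 * b + 4 * b + (1 + 2 / θ) * (2 * b ^ 2 + 4 * b * (1 + b)), fun n hn => ?_⟩
  have hn1 : (1 : ℝ) ≤ n := by exact_mod_cast Nat.pos_of_ne_zero hn
  set V : ℝ := ∑ I ∈ words α n, μ I * y I ^ 2 with hV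
  set a : ℝ := ∑ I ∈ words α n, μ I * y I with ha
  have ha0 : 0 ≤ a := hL n
  have hab : a ≤ b * n := by
    calc a ≤ ∑ I ∈ words α n, μ I * (b * n) := by
          refine Finset.sum_le_sum fun I hI => mul_le_mul_of_nonneg_left ?_ (hμ.nonneg I)
          have h1 := (le_abs_self _).trans (hyabs I)
          rw [mem_words.1 hI] at h1
          have h2 : 0 ≤ κ * (r : ℝ) * n := by positivity
          have h3 : 0 ≤ |L| * (r : ℝ) * n := by positivity
          have h4 : 0 ≤ |c₁| * n := by positivity
          have h5 : 0 ≤ |L| * n := by positivity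
          have h6 : 0 ≤ κ * ((n : ℝ) - 1) := mul_nonneg hκ0 (by linarith)
          rw [hb]
          linarith
      _ = b * n := by rw [← Finset.sum_mul, hμ.sum_words, one_mul]
  set N : ℕ := 2 * n + r with hN
  have hpt : ∀ k ∈ Finset.range r, ∀ J ∈ words α N, μ J ≠ 0 →
      y J ^ 2 ≤ (1 + θ / 2) * (2 * y (J.take n) ^ 2 + 2 * y ((J.drop (n + k)).take n) ^ 2 -
        (y (J.take n) - y ((J.drop (n + k)).take n)) ^ 2) +
        (1 + 2 / θ) * (2 * b ^ 2 +
          2 * b * n * (y (J.take n) + y ((J.drop (n + k)).take n) + c₁ - y J)) := by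
    intro k hk J hJ hμJ
    rw [mem_words] at hJ
    rw [Finset.mem_range] at hk
    obtain ⟨I₁, T₁, rfl, hI₁⟩ : ∃ I T, J = I ++ T ∧ I.length = n :=
      ⟨J.take n, J.drop n, by simp, by simp [hJ]; omega⟩
    have hT₁ : T₁.length = n + r := by simp [hI₁] at hJ; omega
    obtain ⟨K, T₂, rfl, hK⟩ : ∃ I T, T₁ = I ++ T ∧ I.length = k :=
      ⟨T₁.take k, T₁.drop k, by simp, by simp [hT₁]; omega⟩
    have hT₂ : T₂.length = n + r - k := by simp [hK] at hT₁; omega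
    obtain ⟨I₂, R, rfl, hI₂⟩ : ∃ I T, T₂ = I ++ T ∧ I.length = n :=
      ⟨T₂.take n, T₂.drop n, by simp, by simp [hT₂]; omega⟩
    have hR : R.length = r - k := by simp [hI₂] at hT₂; omega
    have e1 : (I₁ ++ (K ++ (I₂ ++ R))).take n = I₁ := by simp [← hI₁]
    have e2 : ((I₁ ++ (K ++ (I₂ ++ R))).drop (n + k)).take n = I₂ := by
      have : (I₁ ++ (K ++ (I₂ ++ R))).drop (n + k) = I₂ ++ R := by simp [← hI₁, ← hK]
      rw [this]
      simp [← hI₂]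
    rw [e1, e2]
    have hμ1 := hμ.eq_zero_of_append hμJ
    have hμ2 := hμ.eq_zero_of_append hμ1
    have hs1 := hl _ _ hμJ
    have hs2 := hl _ _ hμ1
    have hs3 := hl _ _ hμ2
    have hrk : (k : ℝ) ≤ r := by exact_mod_cast hk.le
    have hlK : l K ≤ κ * (r + 1) := by
      refine ((le_abs_self _).trans (hκ K)).trans ?_
      rw [hK]
      gcongr
    have hlR : l R ≤ κ * (r + 1) := by
      refine ((le_abs_self _).trans (hκ R)).trans ?_
      have : (R.length : ℝ) ≤ r := by exact_mod_cast (by omega : R.length ≤ r)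
      gcongr
    have hz := (neg_abs_le _).trans' (neg_le_neg (hyabs (I₁ ++ (K ++ (I₂ ++ R)))))
    have hp := (le_abs_self _).trans (hyabs I₁)
    have hq := (le_abs_self _).trans (hyabs I₂)
    have hzdef : y (I₁ ++ (K ++ (I₂ ++ R))) = l (I₁ ++ (K ++ (I₂ ++ R))) - (2 * n + r) * L := by
      simp only [hy, hJ, hN]
      push_cast
      ring
    have hpdef : y I₁ = l I₁ - n * L := by simp only [hy, hI₁]
    have hqdef : y I₂ = l I₂ - n * L := by simp only [hy, hI₂]
    rw [hJ, hN] at hz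
    rw [hI₁] at hp
    rw [hI₂] at hq
    push_cast at hz
    set p := y I₁
    set q := y I₂
    set z := y (I₁ ++ (K ++ (I₂ ++ R)))
    have hD0 : 0 ≤ p + q + c₁ - z := by
      rw [hzdef, hpdef, hqdef, hc₁]
      linarith
    have hDb : p + q + c₁ - z ≤ b * n := by
      have h2 : 0 ≤ κ * (r : ℝ) := by positivity
      have h3 : 0 ≤ |L| * (r : ℝ) := by positivity
      have h4 := le_abs_self c₁
      have h5 : 0 ≤ κ * (r : ℝ) * (n - 1) := mul_nonneg h2 (by linarith)
      have h6 : 0 ≤ |L| * (r : ℝ) * (n - 1) := mul_nonneg h3 (by linarith)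
      have h7 : 0 ≤ |c₁| * ((n : ℝ) - 1) := mul_nonneg (abs_nonneg _) (by linarith)
      have h8 : 0 ≤ κ * ((n : ℝ) - 1) := mul_nonneg hκ0 (by linarith)
      rw [hb]
      linarith
    exact sq_le_of_defect hθ (le_add_of_nonneg_left (by positivity)) hD0 hDb
  set S : ℕ → ℝ := fun k => ∑ J ∈ words α N,
    μ J * (y (J.take n) - y ((J.drop (n + k)).take n)) ^ 2 with hS
  set VN : ℝ := ∑ J ∈ words α N, μ J * y J ^ 2 with hVN
  set aN : ℝ := ∑ J ∈ words α N, μ J * y J with haN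
  have haN0 : 0 ≤ aN := hL N
  -- Integrate `hpt`: by stationarity both windows have moments `V` and `a`, and `-aN` is dropped
  -- since `aN ≥ 0`.
  have hk : ∀ k ∈ Finset.range r, VN ≤ (1 + θ / 2) * (4 * V - S k) +
      (1 + 2 / θ) * (2 * b ^ 2 + 2 * b * n * (2 * a + b)) := by
    intro k hk
    have hkr := Finset.mem_range.1 hk
    have w1 := hμ.sum_window (N := N) (i := 0) (n := n) (by omega) y
    have w2 := hμ.sum_window (N := N) (i := n + k) (n := n) (by omega) y
    have w3 := hμ.sum_window (N := N) (i := 0) (n := n) (by omega) fun I => y I ^ 2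
    have w4 := hμ.sum_window (N := N) (i := n + k) (n := n) (by omega) fun I => y I ^ 2
    simp only [List.drop_zero] at w1 w3
    calc VN ≤ ∑ J ∈ words α N, μ J * ((1 + θ / 2) * (2 * y (J.take n) ^ 2 +
            2 * y ((J.drop (n + k)).take n) ^ 2 -
          (y (J.take n) - y ((J.drop (n + k)).take n)) ^ 2) +
          (1 + 2 / θ) * (2 * b ^ 2 +
          2 * b * n * (y (J.take n) + y ((J.drop (n + k)).take n) + c₁ - y J))) := by
          refine Finset.sum_le_sum fun J hJ => ?_
          rcases eq_or_ne (μ J) 0 with h0 | h0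
          · simp [h0]
          · exact mul_le_mul_of_nonneg_left (hpt k hk J hJ h0) (hμ.nonneg J)
      _ = (1 + θ / 2) * (2 * ∑ J ∈ words α N, μ J * y (J.take n) ^ 2 +
            2 * ∑ J ∈ words α N, μ J * y ((J.drop (n + k)).take n) ^ 2 - S k) +
          (1 + 2 / θ) * (2 * b ^ 2 * ∑ J ∈ words α N, μ J + 2 * b * n *
            (∑ J ∈ words α N, μ J * y (J.take n) +
              ∑ J ∈ words α N, μ J * y ((J.drop (n + k)).take n) +
              c₁ * ∑ J ∈ words α N, μ J - aN)) := by
          simp only [hS, haN, Finset.mul_sum, ← Finset.sum_add_distrib,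
            ← Finset.sum_sub_distrib]
          exact Finset.sum_congr rfl fun J _ => by ring
      _ = (1 + θ / 2) * (2 * V + 2 * V - S k) +
          (1 + 2 / θ) * (2 * b ^ 2 + 2 * b * n * (a + a + c₁ - aN)) := by
          rw [w1, w2, w3, w4, hμ.sum_words, mul_one, mul_one]
      _ ≤ _ := by
          have h1 : |c₁| ≤ b := le_add_of_nonneg_left (by positivity)
          have h2 := le_abs_self c₁
          have h3 : a + a + c₁ - aN ≤ 2 * a + b := by linarith
          have h4 : 2 * V + 2 * V - S k = 4 * V - S k := by ring
          rw [h4]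
          gcongr
  -- For independent blocks the mean square difference is `2 * V - 2 * a ^ 2`; mixing keeps a
  -- proportion `θ` of it, on average over the gaps.
  have hsumS : θ * r * (2 * V - 2 * a ^ 2) ≤ ∑ k ∈ Finset.range r, S k := by
    refine le_trans (le_of_eq ?_) (hmix n hn (fun I J => (y I - y J) ^ 2) fun _ _ => sq_nonneg _)
    congr 1
    have h1 : ∀ I ∈ words α n, ∑ J ∈ words α n, μ I * μ J * (y I - y J) ^ 2 =
        μ I * y I ^ 2 + μ I * V - 2 * a * (μ I * y I) := by
      intro I _
      calc _ = μ I * y I ^ 2 * ∑ J ∈ words α n, μ J + μ I * V - 2 * (μ I * y I) * a := by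
            simp only [hV, ha, Finset.mul_sum, ← Finset.sum_add_distrib,
              ← Finset.sum_sub_distrib]
            exact Finset.sum_congr rfl fun J _ => by ring
        _ = _ := by rw [hμ.sum_words]; ring
    rw [Finset.sum_congr rfl h1, Finset.sum_sub_distrib, Finset.sum_add_distrib,
      ← Finset.sum_mul, ← Finset.mul_sum, hμ.sum_words]
    change _ = V + 1 * V - 2 * a * a
    ring
  have hr0 : (0 : ℝ) < r := by exact_mod_cast hr
  have htot := Finset.sum_le_sum hk
  rw [Finset.sum_const, Finset.card_range, nsmul_eq_mul, Finset.sum_add_distrib,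
    ← Finset.mul_sum, Finset.sum_sub_distrib, Finset.sum_const, Finset.sum_const,
    Finset.card_range, nsmul_eq_mul, nsmul_eq_mul] at htot
  set Q : ℝ := 2 * b ^ 2 + 2 * b * n * (2 * a + b) with hQ
  have h1 : r * VN ≤ r * ((1 + θ / 2) * (4 * V - θ * (2 * V - 2 * a ^ 2)) + (1 + 2 / θ) * Q) := by
    have := mul_le_mul_of_nonneg_left hsumS (by positivity : 0 ≤ 1 + θ / 2)
    linarith
  have h2 := le_of_mul_le_mul_left h1 hr0
  have hQb : Q ≤ (2 * b ^ 2 + 4 * b * (1 + b)) * (n * (1 + a)) := by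
    have h3 : 0 ≤ b * (n : ℝ) * a := by positivity
    have h4 : 0 ≤ b * b * ((n : ℝ) - 1) := mul_nonneg (by positivity) (by linarith)
    have h5 : 0 ≤ b * b * (n : ℝ) * a := by positivity
    have h6 : 0 ≤ b * (n : ℝ) := by positivity
    have h7 : 0 ≤ b * b * (n : ℝ) := by positivity
    rw [hQ]
    linarith
  have ha2 : (1 + θ / 2) * (2 * θ * a ^ 2) ≤ (2 * b + 4 * b) * (n * (1 + a)) := by
    have h3 : a ^ 2 ≤ b * n * a := by
      rw [sq]
      exact mul_le_mul_of_nonneg_right hab ha0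
    have h4 : (1 + θ / 2) * (2 * θ) ≤ 3 := by
      linarith [mul_le_mul hθ1 hθ1 hθ.le zero_le_one]
    have h5 : 0 ≤ b * (n : ℝ) * a := by positivity
    have h6 : 0 ≤ b * (n : ℝ) := by positivity
    calc (1 + θ / 2) * (2 * θ * a ^ 2) = (1 + θ / 2) * (2 * θ) * a ^ 2 := by ring
      _ ≤ 3 * (b * n * a) := by gcongr
      _ ≤ _ := by linarith
  calc VN ≤ _ := h2
    -- The contraction: `(1 + θ / 2) * (4 - 2 * θ) = 4 - θ ^ 2`.
    _ = (4 - θ ^ 2) * V + (1 + θ / 2) * (2 * θ * a ^ 2) + (1 + 2 / θ) * Q := by ring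
    _ ≤ (4 - θ ^ 2) * V + (2 * b + 4 * b) * (n * (1 + a)) +
        (1 + 2 / θ) * ((2 * b ^ 2 + 4 * b * (1 + b)) * (n * (1 + a))) := by gcongr
    _ = _ := by ring

end StationaryWeight

theorem tendsto_zero_of_contracting {x δ : ℕ → ℝ} {ρ : ℝ} (hρ0 : 0 ≤ ρ) (hρ1 : ρ < 1)
    (hx : ∀ j, 0 ≤ x j) (hδ : Tendsto δ atTop (𝓝 0)) (h : ∀ j, x (j + 1) ≤ ρ * x j + δ j) :
    Tendsto x atTop (𝓝 0) := by
  rw [Metric.tendsto_atTop]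
  intro ε hε
  have hpos : 0 < (1 - ρ) * (ε / 2) := by
    have : 0 < 1 - ρ := by linarith
    positivity
  obtain ⟨j₀, hj₀⟩ := eventually_atTop.1 (hδ.eventually_lt_const hpos)
  have hind : ∀ i, x (j₀ + i) ≤ ρ ^ i * x j₀ + ε / 2 := by
    intro i
    induction i with
    | zero => simpa using (half_pos hε).le
    | succ i ih =>
      have h1 := h (j₀ + i)
      have h2 := hj₀ (j₀ + i) (by omega)
      have h3 := mul_le_mul_of_nonneg_left ih hρ0
      rw [← add_assoc, pow_succ]
      linarith
  have hgeo : Tendsto (fun i => ρ ^ i * x j₀) atTop (𝓝 (0 * x j₀)) :=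
    (tendsto_pow_atTop_nhds_zero_of_lt_one hρ0 hρ1).mul_const _
  rw [zero_mul] at hgeo
  obtain ⟨i₀, hi₀⟩ := eventually_atTop.1 (hgeo.eventually_lt_const (half_pos hε))
  refine ⟨j₀ + i₀, fun j hj => ?_⟩
  obtain ⟨i, rfl⟩ := Nat.exists_eq_add_of_le (show j₀ ≤ j by omega)
  rw [Real.dist_0_eq_abs, abs_of_nonneg (hx _)]
  have h1 := hind i
  have h2 := hi₀ i (by omega)
  linarith

/-! ### Concentration and exponential moments -/

namespace StationaryWeight

variable {α : Type*} [Fintype α] {μ : List α → ℝ}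

/-- A subadditive function on words concentrates around its mean, along a sequence of lengths
of bounded ratios. -/
theorem exists_concentration (hμ : StationaryWeight μ) {w : List α → ℝ}
    (hw : QuasiMultiplicative w) {D : ℝ} (hD : 0 < D)
    (hwμ : ∀ I, I ≠ [] → w I ≤ D * μ I ∧ μ I ≤ D * w I)
    {l : List α → ℝ} {κ : ℝ} (hκ0 : 0 ≤ κ) (hκ : ∀ I, |l I| ≤ κ * (I.length + 1))
    (hl : ∀ I J, μ (I ++ J) ≠ 0 → l (I ++ J) ≤ l I + l J) :
    ∃ (L : ℝ) (N : ℕ → ℕ), StrictMono N ∧ (∀ j, N j ≠ 0) ∧ (∀ j, N (j + 1) ≤ 3 * N j) ∧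
      Tendsto (fun j => (∑ I ∈ words α (N j), μ I * (l I - I.length * L) ^ 2) / (N j : ℝ) ^ 2)
        atTop (𝓝 0) := by
  obtain ⟨L, hL, hlim⟩ := hμ.exists_mean hκ0 hκ hl
  obtain ⟨r, θ, hθ, hθ1, hr, hmix⟩ := hμ.exists_mixing hw hD hwμ
  obtain ⟨B, hB⟩ := hμ.exists_sq_step hκ0 hκ hl hL hr hθ hθ1 hmix
  -- Starting at `r` keeps `r ≤ N j`, so consecutive lengths have ratio at least `2`, which turns `4
  -- - θ ^ 2` into `1 - θ ^ 2 / 4`, and at most `3`.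
  set N : ℕ → ℕ := fun j => Nat.rec r (fun _ n => 2 * n + r) j with hN
  have hNs : ∀ j, N (j + 1) = 2 * N j + r := fun j => rfl
  have hNr : ∀ j, r ≤ N j := by
    intro j
    induction j with
    | zero => exact le_rfl
    | succ j ih => rw [hNs]; omega
  have hmono : StrictMono N := strictMono_nat_of_lt_succ fun j => by rw [hNs]; omega
  have hne : ∀ j, N j ≠ 0 := fun j => by have := hNr j; omega
  refine ⟨L, N, hmono, hne, fun j => by have := hNr j; rw [hNs]; omega, ?_⟩
  set V : ℕ → ℝ := fun n => ∑ I ∈ words α n, μ I * (l I - I.length * L) ^ 2 with hV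
  have hV0 : ∀ n, 0 ≤ V n := fun n =>
    Finset.sum_nonneg fun I _ => mul_nonneg (hμ.nonneg I) (sq_nonneg _)
  set a : ℕ → ℝ := fun n => ∑ I ∈ words α n, μ I * (l I - I.length * L) with ha
  have hδ : Tendsto (fun n : ℕ => |B| / 4 * (1 / n + a n / n)) atTop (𝓝 0) := by
    have h1 := ((tendsto_const_div_atTop_nhds_zero_nat (1 : ℝ)).add hlim).const_mul (|B| / 4)
    simpa using h1
  refine tendsto_zero_of_contracting (ρ := 1 - θ ^ 2 / 4) (by nlinarith) (by nlinarith)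
    (fun j => div_nonneg (hV0 _) (sq_nonneg _)) (hδ.comp hmono.tendsto_atTop) fun j => ?_
  have hn : (0 : ℝ) < N j := by exact_mod_cast Nat.pos_of_ne_zero (hne j)
  have ha0 : 0 ≤ a (N j) := hL _
  have h4 : (0 : ℝ) ≤ 4 - θ ^ 2 := by nlinarith
  have hstep : V (N (j + 1)) ≤ (4 - θ ^ 2) * V (N j) + |B| * N j * (1 + a (N j)) := by
    refine (hB (N j) (hne j)).trans ?_
    gcongr
    exact le_abs_self B
  have hsq : 4 * (N j : ℝ) ^ 2 ≤ (N (j + 1) : ℝ) ^ 2 := by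
    rw [hNs]
    push_cast
    nlinarith [Nat.cast_nonneg (α := ℝ) r, hn]
  calc V (N (j + 1)) / (N (j + 1) : ℝ) ^ 2
      ≤ ((4 - θ ^ 2) * V (N j) + |B| * N j * (1 + a (N j))) / (4 * (N j : ℝ) ^ 2) := by
        have := hV0 (N j)
        gcongr
    _ = (1 - θ ^ 2 / 4) * (V (N j) / (N j : ℝ) ^ 2) +
        |B| / 4 * (1 / (N j : ℝ) + a (N j) / (N j : ℝ)) := by
        field_simp

/-- The exponential moments of a function on words, bounded by means of its second moment. -/
theorem sum_exp_le (hμ : StationaryWeight μ) {l : List α → ℝ} {κ : ℝ} (hκ0 : 0 ≤ κ)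
    (hκ : ∀ I, |l I| ≤ κ * (I.length + 1)) (L t : ℝ) {ε : ℝ} (hε : 0 < ε) {n : ℕ} (hn : n ≠ 0) :
    ∑ I ∈ words α n, μ I * Real.exp (t * l I) ≤ Real.exp (n * (t * L + |t| * ε)) +
      Real.exp (|t| * n * (2 * κ)) / ε ^ 2 *
        ((∑ I ∈ words α n, μ I * (l I - I.length * L) ^ 2) / (n : ℝ) ^ 2) := by
  have hn1 : (1 : ℝ) ≤ n := by exact_mod_cast Nat.pos_of_ne_zero hn
  have hpt : ∀ I ∈ words α n, Real.exp (t * l I) ≤ Real.exp (n * (t * L + |t| * ε)) +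
      Real.exp (|t| * n * (2 * κ)) / ε ^ 2 * ((l I - I.length * L) ^ 2 / (n : ℝ) ^ 2) := by
    intro I hI
    rw [mem_words] at hI
    have hlI := hκ I
    rw [hI] at hlI ⊢
    -- Chebyshev: off the typical words, the crude bound on the exponential is multiplied by a
    -- quotient that is at least `1` there.
    rcases le_or_gt |l I - n * L| (n * ε) with h | h
    · have h1 : t * (l I - n * L) ≤ |t| * (n * ε) :=
        (le_abs_self _).trans (by rw [abs_mul]; gcongr)
      have h2 : Real.exp (t * l I) ≤ Real.exp (n * (t * L + |t| * ε)) :=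
        Real.exp_le_exp.2 (by linarith)
      exact h2.trans (le_add_of_nonneg_right (by positivity))
    · have h1 : t * l I ≤ |t| * n * (2 * κ) := by
        calc t * l I ≤ |t| * |l I| := by rw [← abs_mul]; exact le_abs_self _
          _ ≤ |t| * (κ * (n + n)) := by
            refine mul_le_mul_of_nonneg_left (hlI.trans ?_) (abs_nonneg t)
            gcongr
          _ = _ := by ring
      have h2 : 1 ≤ (l I - n * L) ^ 2 / (n * ε) ^ 2 := by
        rw [one_le_div (by positivity), ← sq_abs (l I - n * L)]
        gcongr
      calc Real.exp (t * l I) ≤ Real.exp (|t| * n * (2 * κ)) * 1 := by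
            rw [mul_one]
            exact Real.exp_le_exp.2 h1
        _ ≤ Real.exp (|t| * n * (2 * κ)) * ((l I - n * L) ^ 2 / (n * ε) ^ 2) := by gcongr
        _ = Real.exp (|t| * n * (2 * κ)) / ε ^ 2 * ((l I - n * L) ^ 2 / (n : ℝ) ^ 2) := by
            field_simp
        _ ≤ _ := le_add_of_nonneg_left (Real.exp_pos _).le
  calc ∑ I ∈ words α n, μ I * Real.exp (t * l I)
      ≤ ∑ I ∈ words α n, μ I * (Real.exp (n * (t * L + |t| * ε)) +
        Real.exp (|t| * n * (2 * κ)) / ε ^ 2 * ((l I - I.length * L) ^ 2 / (n : ℝ) ^ 2)) :=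
        Finset.sum_le_sum fun I hI => mul_le_mul_of_nonneg_left (hpt I hI) (hμ.nonneg I)
    _ = (∑ I ∈ words α n, μ I) * Real.exp (n * (t * L + |t| * ε)) +
        Real.exp (|t| * n * (2 * κ)) / ε ^ 2 *
        ((∑ I ∈ words α n, μ I * (l I - I.length * L) ^ 2) / (n : ℝ) ^ 2) := by
        simp only [Finset.sum_mul, Finset.mul_sum, Finset.sum_div, ← Finset.sum_add_distrib]
        exact Finset.sum_congr rfl fun I _ => by ring
    _ = _ := by rw [hμ.sum_words, one_mul]

end StationaryWeight

/-! ### Differentiability of the growth rate -/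

namespace QuasiMultiplicative

variable {α : Type*} [Fintype α] {φ : List α → ℝ}

/-- The growth rate of the `q`-th powers has a linear upper bound up to first order. -/
theorem exists_upper_slope (hφ : QuasiMultiplicative φ) {κ : ℝ} (hκ0 : 0 ≤ κ)
    (hκ : ∀ I, |Real.log (φ I)| ≤ κ * (I.length + 1)) {P : ℝ → ℝ}
    (hP : ∀ q, 0 < q → ∀ n : ℕ, Real.exp (n * P q) ≤ totalWeight (fun J => φ J ^ q) n)
    {q : ℝ} (hq : 0 < q) {C : ℝ}
    (hC : ∀ n : ℕ, totalWeight (fun J => φ J ^ q) n ≤ C * Real.exp (n * P q)) :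
    ∃ L : ℝ, ∀ ε > 0, ∃ δ > 0, ∀ t, |t| < δ → 0 < q + t →
      P (q + t) - P q ≤ t * L + ε * |t| := by
  set w : List α → ℝ := fun J => φ J ^ q * Real.exp (-(J.length * P q)) with hwdef
  have hw : QuasiMultiplicative w := (hφ.rpow hq).mul_exp_length (P q)
  have hwt : ∀ n, totalWeight w n =
      totalWeight (fun J => φ J ^ q) n * Real.exp (-(n * P q)) :=
    totalWeight_mul_exp_length _ _
  have hw1 : ∀ n, 1 ≤ totalWeight w n := by
    intro n
    rw [hwt, Real.exp_neg, ← div_eq_mul_inv, one_le_div (Real.exp_pos _)]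
    exact hP q hq n
  have hwC : ∀ n, totalWeight w n ≤ C := by
    intro n
    rw [hwt, Real.exp_neg, ← div_eq_mul_inv, div_le_iff₀ (Real.exp_pos _)]
    exact hC n
  obtain ⟨μ, hμ, D, hD, hwμ⟩ := hw.exists_stationaryWeight hw1 hwC
  -- Where `φ` vanishes, `Real.log` returns `0` and subadditivity of the logarithm may fail;
  -- non-empty words of this kind are `μ`-null.
  have hφ0 : ∀ I J, μ (I ++ J) ≠ 0 → φ (I ++ J) ≠ 0 := by
    intro I J h h0
    rcases eq_or_ne (I ++ J) [] with hnil | hnil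
    · rw [hnil] at h0
      linarith [hφ.one_le_nil]
    · refine h (le_antisymm ((hwμ _ hnil).2.trans ?_) (hμ.nonneg _))
      simp [hwdef, h0, Real.zero_rpow hq.ne']
  have hl : ∀ I J, μ (I ++ J) ≠ 0 →
      Real.log (φ (I ++ J)) ≤ Real.log (φ I) + Real.log (φ J) := by
    intro I J h
    have h1 : 0 < φ (I ++ J) := lt_of_le_of_ne (hφ.nonneg _) (hφ0 I J h).symm
    have h2 := hφ.append_le I J
    have h3 : φ I * φ J ≠ 0 := (h1.trans_le h2).ne'
    rw [← Real.log_mul (left_ne_zero_of_mul h3) (right_ne_zero_of_mul h3)]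
    exact Real.log_le_log h1 h2
  obtain ⟨L, N, hmono, hN0, hN3, hlim⟩ := hμ.exists_concentration hw hD hwμ hκ0 hκ hl
  -- One length suffices because `hP` bounds the totals below at every `n` with no constant; `φ ^ (q
  -- + t)` is the weight `φ ^ q` tilted by `exp (t log φ)`.
  have hmain : ∀ t, 0 < q + t → ∀ n : ℕ, n ≠ 0 → Real.exp (n * (P (q + t) - P q)) ≤
      D * ∑ I ∈ words α n, μ I * Real.exp (t * Real.log (φ I)) := by
    intro t ht n hn
    have h1 : totalWeight (fun J => φ J ^ (q + t)) n * Real.exp (-(n * P q)) ≤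
        D * ∑ I ∈ words α n, μ I * Real.exp (t * Real.log (φ I)) := by
      rw [totalWeight, Finset.sum_mul, Finset.mul_sum]
      refine Finset.sum_le_sum fun I hI => ?_
      have hIn := mem_words.1 hI
      have hne : I ≠ [] := by
        rintro rfl
        exact hn (by simpa using hIn.symm)
      have h2 := (hwμ I hne).1
      rcases eq_or_lt_of_le (hφ.nonneg I) with h0 | h0
      · rw [← h0, Real.zero_rpow ht.ne', zero_mul]
        exact mul_nonneg hD.le (mul_nonneg (hμ.nonneg _) (Real.exp_pos _).le)
      · have h3 : φ I ^ (q + t) * Real.exp (-(n * P q)) =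
            w I * Real.exp (t * Real.log (φ I)) := by
          change _ = φ I ^ q * Real.exp (-(I.length * P q)) * _
          rw [Real.rpow_add h0, Real.rpow_def_of_pos h0 t, hIn, mul_comm t]
          ring
        rw [h3, ← mul_assoc]
        exact mul_le_mul_of_nonneg_right h2 (Real.exp_pos _).le
    refine le_trans ?_ h1
    rw [mul_sub, sub_eq_add_neg, Real.exp_add]
    exact mul_le_mul_of_nonneg_right (hP _ ht n) (Real.exp_pos _).le
  refine ⟨L, fun ε hε => ?_⟩
  -- Once `|t| * n ≥ S`, the constant `log (2 * D)` is at most `n * |t| * (ε / 2)`. The threshold in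
  -- `hη` makes the tail term at most `E` as long as `|t| * n ≤ 3 * S`.
  set S : ℝ := |Real.log (2 * D)| / (ε / 2) + 1 with hS
  have hS0 : 0 < S := by positivity
  have hη : 0 < (ε / 2) ^ 2 * Real.exp (-(3 * S * (2 * κ))) * Real.exp (-(3 * S * |L|)) := by
    positivity
  obtain ⟨j₀, hj₀⟩ := eventually_atTop.1 (hlim.eventually_lt_const hη)
  have hNpos : ∀ j, (0 : ℝ) < N j := fun j => by exact_mod_cast Nat.pos_of_ne_zero (hN0 j)
  refine ⟨S / N j₀, div_pos hS0 (hNpos _), fun t ht hqt => ?_⟩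
  rcases eq_or_ne t 0 with rfl | ht0
  · simp
  have htpos : 0 < |t| := abs_pos.2 ht0
  -- The first such `j` satisfies `S ≤ |t| * N j ≤ 3 * S`, by the bounded ratios, and `|t| < S / N
  -- j₀` forces `j > j₀`.
  have hex : ∃ j, S ≤ |t| * N j := by
    obtain ⟨k, hk⟩ := exists_nat_ge (S / |t|)
    refine ⟨k, ?_⟩
    rw [div_le_iff₀ htpos] at hk
    have : (k : ℝ) ≤ N k := by exact_mod_cast hmono.id_le k
    nlinarith
  classical
  have hfind := Nat.find_spec hex
  have hmin : ∀ i, i < Nat.find hex → |t| * N i < S := fun i hi => not_le.1 (Nat.find_min hex hi)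
  set j := Nat.find hex
  have hj : j₀ < j := by
    by_contra hle
    have h1 : (N j : ℝ) ≤ N j₀ := by exact_mod_cast hmono.monotone (not_lt.1 hle)
    rw [lt_div_iff₀ (hNpos _)] at ht
    have := mul_le_mul_of_nonneg_left h1 htpos.le
    linarith
  obtain ⟨i, hi⟩ : ∃ i, j = i + 1 := ⟨j - 1, by omega⟩
  have hupper : |t| * N j ≤ 3 * S := by
    have h1 : (N j : ℝ) ≤ 3 * N i := by
      rw [hi]
      exact_mod_cast hN3 i
    have h2 := hmin i (by omega)
    have := mul_le_mul_of_nonneg_left h1 htpos.le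
    linarith
  have hv := hj₀ j hj.le
  set n := N j
  have hn : (0 : ℝ) < n := hNpos j
  have hexp := hμ.sum_exp_le hκ0 hκ L t (half_pos hε) (hN0 j)
  set v : ℝ := (∑ I ∈ words α n, μ I * (Real.log (φ I) - I.length * L) ^ 2) / (n : ℝ) ^ 2
  have hv0 : 0 ≤ v := div_nonneg
    (Finset.sum_nonneg fun I _ => mul_nonneg (hμ.nonneg I) (sq_nonneg _)) (sq_nonneg _)
  set E : ℝ := Real.exp (n * (t * L + |t| * (ε / 2))) with hE
  have hsecond : Real.exp (|t| * n * (2 * κ)) / (ε / 2) ^ 2 * v ≤ E := by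
    calc Real.exp (|t| * n * (2 * κ)) / (ε / 2) ^ 2 * v
        ≤ Real.exp (3 * S * (2 * κ)) / (ε / 2) ^ 2 *
          ((ε / 2) ^ 2 * Real.exp (-(3 * S * (2 * κ))) * Real.exp (-(3 * S * |L|))) := by
          gcongr
      _ = Real.exp (-(3 * S * |L|)) := by
          rw [Real.exp_neg (3 * S * (2 * κ))]
          field_simp
      _ ≤ E := by
          refine Real.exp_le_exp.2 ?_
          have h1 : -(t * L) ≤ |t| * |L| := by
            rw [← abs_mul]
            exact neg_le_abs _
          have h2 := mul_le_mul_of_nonneg_right hupper (abs_nonneg L)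
          have h3 := mul_le_mul_of_nonneg_left h1 hn.le
          have h4 : 0 ≤ n * (|t| * (ε / 2)) := by positivity
          linarith
  have hfin : Real.exp (n * (P (q + t) - P q)) ≤ 2 * D * E := by
    refine (hmain t hqt n (hN0 j)).trans ?_
    have := mul_le_mul_of_nonneg_left (hexp.trans (add_le_add_right hsecond E)) hD.le
    linarith
  have hlog := Real.log_le_log (Real.exp_pos _) hfin
  rw [Real.log_exp, Real.log_mul (by positivity) (Real.exp_pos _).ne', Real.log_exp] at hlog
  have hSlog : Real.log (2 * D) ≤ n * (|t| * (ε / 2)) := by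
    have h1 : |Real.log (2 * D)| ≤ S * (ε / 2) := by
      rw [hS, add_mul, div_mul_cancel₀ _ (by positivity)]
      linarith
    have h2 := mul_le_mul_of_nonneg_right hfind (half_pos hε).le
    linarith [le_abs_self (Real.log (2 * D))]
  refine le_of_mul_le_mul_left ?_ hn
  linarith

/-- The growth rate of the `q`-th powers is midpoint convex in `q`. -/
theorem two_mul_growth_rate_le (hφ : QuasiMultiplicative φ) {P : ℝ → ℝ}
    (hP : ∀ q, 0 < q → Tendsto
      (fun n : ℕ => (1 / (n : ℝ)) * Real.log (totalWeight (fun J => φ J ^ q) n)) atTop (𝓝 (P q)))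
    {q t : ℝ} (h1 : 0 < q + t) (h2 : 0 < q - t) : 2 * P q ≤ P (q + t) + P (q - t) := by
  have hq : 0 < q := by linarith
  refine le_of_tendsto_of_tendsto' ((hP q hq).const_mul 2) ((hP _ h1).add (hP _ h2)) fun n => ?_
  -- Cauchy–Schwarz with the exponents `(q + t) / 2` and `(q - t) / 2`.
  have hcs : totalWeight (fun J => φ J ^ q) n ^ 2 ≤
      totalWeight (fun J => φ J ^ (q + t)) n * totalWeight (fun J => φ J ^ (q - t)) n := by
    have h := Finset.sum_mul_sq_le_sq_mul_sq (words α n)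
      (fun J => φ J ^ ((q + t) / 2)) (fun J => φ J ^ ((q - t) / 2))
    have e0 : ∀ J, φ J ^ ((q + t) / 2) * φ J ^ ((q - t) / 2) = φ J ^ q := by
      intro J
      have : (q + t) / 2 + (q - t) / 2 = q := by ring
      rw [← Real.rpow_add' (hφ.nonneg J) (by rw [this]; exact hq.ne'), this]
    have e1 : ∀ (s : ℝ) J, (φ J ^ (s / 2)) ^ 2 = φ J ^ s := by
      intro s J
      rw [← Real.rpow_natCast, ← Real.rpow_mul (hφ.nonneg J)]
      congr 1
      push_cast
      ring
    simp only [e0, e1] at h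
    exact h
  have p0 := (hφ.rpow hq).totalWeight_pos n
  have p1 := (hφ.rpow h1).totalWeight_pos n
  have p2 := (hφ.rpow h2).totalWeight_pos n
  have h := Real.log_le_log (by positivity) hcs
  rw [Real.log_pow, Real.log_mul p1.ne' p2.ne'] at h
  push_cast at h
  rw [← mul_add, mul_left_comm]
  exact mul_le_mul_of_nonneg_left h (by positivity)

/-- The exponential growth rate of the total `q`-th powers of a quasi-multiplicative weight is
differentiable in `q`. -/
theorem exists_differentiable_growth_rate (hφ : QuasiMultiplicative φ) {κ : ℝ} (hκ0 : 0 ≤ κ)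
    (hκ : ∀ I, |Real.log (φ I)| ≤ κ * (I.length + 1)) :
    ∃ P : ℝ → ℝ, ∀ q, 0 < q → Tendsto
      (fun n : ℕ => (1 / (n : ℝ)) * Real.log (totalWeight (fun J => φ J ^ q) n)) atTop
        (𝓝 (P q)) ∧ DifferentiableAt ℝ P q := by
  have hex : ∀ q : ℝ, ∃ P : ℝ, 0 < q → Tendsto
      (fun n : ℕ => (1 / (n : ℝ)) * Real.log (totalWeight (fun J => φ J ^ q) n)) atTop (𝓝 P) ∧
      (∀ n : ℕ, Real.exp (n * P) ≤ totalWeight (fun J => φ J ^ q) n) ∧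
      ∃ C : ℝ, ∀ n : ℕ, totalWeight (fun J => φ J ^ q) n ≤ C * Real.exp (n * P) := by
    intro q
    rcases le_or_gt q 0 with hq | hq
    · exact ⟨0, fun h => absurd hq (not_le.2 h)⟩
    obtain ⟨P, hP⟩ := (hφ.rpow hq).exists_growth_rate (κ := q * κ) (by positivity) (by
      intro J hJ
      have h0 : φ J ≠ 0 := by
        intro h
        exact hJ (by rw [h, Real.zero_rpow hq.ne'])
      rw [Real.log_rpow (lt_of_le_of_ne (hφ.nonneg J) h0.symm)]
      have := mul_le_mul_of_nonneg_left (abs_le.1 (hκ J)).1 hq.le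
      linarith)
    exact ⟨P, fun _ => hP⟩
  choose P hP using hex
  refine ⟨P, fun q hq => ⟨(hP q hq).1, ?_⟩⟩
  obtain ⟨-, -, C, hC⟩ := hP q hq
  obtain ⟨L, hL⟩ := hφ.exists_upper_slope hκ0 hκ (fun q hq => (hP q hq).2.1) hq hC
  refine HasDerivAt.differentiableAt (f' := L) ?_
  rw [hasDerivAt_iff_isLittleO_nhds_zero, Asymptotics.isLittleO_iff]
  intro ε hε
  obtain ⟨δ, hδ, hδL⟩ := hL ε hε
  have hmin : 0 < min δ q := lt_min hδ hq
  filter_upwards [Metric.ball_mem_nhds (0 : ℝ) hmin] with t ht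
  rw [Metric.mem_ball, Real.dist_0_eq_abs, lt_min_iff] at ht
  have ht1 : 0 < q + t := by linarith [(abs_lt.1 ht.2).1]
  have ht2 : 0 < q + -t := by linarith [(abs_lt.1 ht.2).2]
  have h1 := hδL t ht.1 ht1
  have h2 := hδL (-t) (by rw [abs_neg]; exact ht.1) ht2
  -- Convexity gives `P (q + t) - P q ≥ P q - P (q - t)`, so the upper bound at `-t` is a lower
  -- bound at `t`.
  have h3 := hφ.two_mul_growth_rate_le (fun q hq => (hP q hq).1) ht1 ht2
  rw [abs_neg] at h2
  rw [sub_eq_add_neg q t] at h3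
  rw [Real.norm_eq_abs, Real.norm_eq_abs, smul_eq_mul, abs_le]
  constructor <;> linarith

end QuasiMultiplicative

/-! ### Norms of non-negative matrix products -/

section EntrySum

variable {d : ℕ}

theorem entrySum_nonneg {B : Matrix (Fin d) (Fin d) ℝ} (hB : ∀ a b, 0 ≤ B a b) :
    0 ≤ entrySum B :=
  Finset.sum_nonneg fun a _ => Finset.sum_nonneg fun b _ => hB a b

theorem le_entrySum {B : Matrix (Fin d) (Fin d) ℝ} (hB : ∀ a b, 0 ≤ B a b) (a b : Fin d) :
    B a b ≤ entrySum B :=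
  (Finset.single_le_sum (f := fun b => B a b) (fun b _ => hB a b) (Finset.mem_univ b)).trans
    (Finset.single_le_sum (f := fun a => ∑ b, B a b)
      (fun a _ => Finset.sum_nonneg fun b _ => hB a b) (Finset.mem_univ a))

theorem entrySum_sum {ι : Type*} (s : Finset ι) (B : ι → Matrix (Fin d) (Fin d) ℝ) :
    entrySum (∑ i ∈ s, B i) = ∑ i ∈ s, entrySum (B i) := by
  simp only [entrySum, Matrix.sum_apply]
  rw [Finset.sum_comm]
  refine (Finset.sum_congr rfl fun b _ => Finset.sum_comm).trans ?_
  rw [Finset.sum_comm]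
  exact Finset.sum_congr rfl fun i _ => Finset.sum_comm

theorem entrySum_mul (B C : Matrix (Fin d) (Fin d) ℝ) :
    entrySum (B * C) = ∑ k, (∑ a, B a k) * ∑ b, C k b := by
  simp only [entrySum, Matrix.mul_apply, Finset.sum_mul_sum]
  exact (Finset.sum_congr rfl fun a _ => Finset.sum_comm).trans Finset.sum_comm

theorem entrySum_mul_le {B C : Matrix (Fin d) (Fin d) ℝ} (hB : ∀ a b, 0 ≤ B a b)
    (hC : ∀ a b, 0 ≤ C a b) : entrySum (B * C) ≤ entrySum B * entrySum C := by
  rw [entrySum_mul]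
  calc ∑ k, (∑ a, B a k) * ∑ b, C k b ≤ ∑ k, (∑ a, B a k) * entrySum C := by
        refine Finset.sum_le_sum fun k _ => mul_le_mul_of_nonneg_left ?_
          (Finset.sum_nonneg fun a _ => hB a k)
        exact Finset.single_le_sum (f := fun k => ∑ b, C k b)
          (fun k _ => Finset.sum_nonneg fun b _ => hC k b) (Finset.mem_univ k)
    _ = entrySum B * entrySum C := by
        rw [← Finset.sum_mul, Finset.sum_comm]
        rfl

/-- The norm of `B * S * C` is the sum of the entries of `S` weighted by column sums of `B` and row
sums of `C`. -/
theorem le_entrySum_mul_mul {B S C : Matrix (Fin d) (Fin d) ℝ} {δ : ℝ}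
    (hB : ∀ a b, 0 ≤ B a b) (hC : ∀ a b, 0 ≤ C a b) (hS : ∀ a b, δ ≤ S a b) :
    δ * entrySum B * entrySum C ≤ entrySum (B * (S * C)) := by
  have hB' : entrySum B = ∑ k, ∑ a, B a k := Finset.sum_comm
  rw [entrySum_mul, hB', mul_assoc, Finset.sum_mul, Finset.mul_sum]
  refine Finset.sum_le_sum fun k _ => ?_
  rw [mul_left_comm]
  refine mul_le_mul_of_nonneg_left ?_ (Finset.sum_nonneg fun a _ => hB a k)
  simp only [Matrix.mul_apply]
  rw [Finset.sum_comm, entrySum, Finset.mul_sum]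
  refine Finset.sum_le_sum fun j _ => ?_
  rw [← Finset.mul_sum]
  exact mul_le_mul_of_nonneg_right (hS k j) (Finset.sum_nonneg fun b _ => hC j b)

end EntrySum

section WordProd

variable {m d : ℕ} {N : Fin m → Matrix (Fin d) (Fin d) ℝ}

theorem wordProd_append (I J : List (Fin m)) :
    wordProd N (I ++ J) = wordProd N I * wordProd N J := by
  simp [wordProd]

theorem wordProd_cons (i : Fin m) (J : List (Fin m)) :
    wordProd N (i :: J) = N i * wordProd N J := by
  simp [wordProd]

theorem wordProd_nonneg (hN : ∀ i a b, 0 ≤ N i a b) (J : List (Fin m)) (a b : Fin d) :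
    0 ≤ wordProd N J a b := by
  induction J generalizing a b with
  | nil => simp only [wordProd, List.map_nil, List.prod_nil, Matrix.one_apply]; split_ifs <;> simp
  | cons i J ih =>
    rw [wordProd_cons, Matrix.mul_apply]
    exact Finset.sum_nonneg fun k _ => mul_nonneg (hN i a k) (ih k b)

/-- The non-zero norms of the products are bounded above and below by exponentials. -/
theorem exists_abs_log_entrySum_le (hd : 1 ≤ d) (hN : ∀ i a b, 0 ≤ N i a b) :
    ∃ κ : ℝ, 0 ≤ κ ∧ ∀ J : List (Fin m),
      |Real.log (entrySum (wordProd N J))| ≤ κ * (J.length + 1) := by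
  obtain ⟨θ, hθ, hθ1, hθN⟩ : ∃ θ : ℝ, 0 < θ ∧ θ ≤ 1 ∧ ∀ i a b, N i a b ≠ 0 → θ ≤ N i a b := by
    -- Smallest non-zero entry, capped at `1`: `none` contributes `1`, and zero entries are replaced
    -- by `1`.
    set v : Option (Fin m × Fin d × Fin d) → ℝ := fun o => o.elim 1 fun p =>
      if N p.1 p.2.1 p.2.2 = 0 then 1 else N p.1 p.2.1 p.2.2 with hv
    obtain ⟨o, ho⟩ := Finite.exists_min v
    refine ⟨v o, ?_, ho none, fun i a b h => ?_⟩
    · rcases o with _ | p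
      · simp [hv]
      · simp only [hv, Option.elim]
        split_ifs with h
        · exact one_pos
        · exact lt_of_le_of_ne (hN _ _ _) (Ne.symm h)
    · have := ho (some (i, a, b))
      simpa [hv, h] using this
  obtain ⟨β, hβ1, hβ⟩ : ∃ β : ℝ, 1 ≤ β ∧ ∀ i, entrySum (N i) ≤ β := by
    refine ⟨1 + ∑ i, entrySum (N i),
      le_add_of_nonneg_right (Finset.sum_nonneg fun i _ => entrySum_nonneg (hN i)), fun i => ?_⟩
    have := Finset.single_le_sum (f := fun i => entrySum (N i))
      (fun i _ => entrySum_nonneg (hN i)) (Finset.mem_univ i)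
    linarith
  have hd1 : (1 : ℝ) ≤ d := by exact_mod_cast hd
  have hupper : ∀ J : List (Fin m), entrySum (wordProd N J) ≤ d * β ^ J.length := by
    intro J
    induction J with
    | nil => simp [wordProd, entrySum, Matrix.one_apply]
    | cons i J ih =>
      rw [wordProd_cons, List.length_cons, pow_succ]
      refine (entrySum_mul_le (hN i) (wordProd_nonneg hN J)).trans ?_
      have := mul_le_mul (hβ i) ih (entrySum_nonneg (wordProd_nonneg hN J)) (by linarith)
      linarith
  -- Non-negative terms do not cancel, so a non-zero entry dominates a product of non-zero entries
  -- of the factors.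
  have hlower : ∀ (J : List (Fin m)) a b, wordProd N J a b ≠ 0 →
      θ ^ J.length ≤ wordProd N J a b := by
    intro J
    induction J with
    | nil =>
      intro a b h
      simp only [wordProd, List.map_nil, List.prod_nil, Matrix.one_apply] at h ⊢
      split_ifs at h ⊢ <;> simp_all
    | cons i J ih =>
      intro a b h
      rw [wordProd_cons, Matrix.mul_apply] at h ⊢
      obtain ⟨k, -, hk⟩ := Finset.exists_ne_zero_of_sum_ne_zero h
      refine le_trans ?_ (Finset.single_le_sum (f := fun k => N i a k * wordProd N J k b)
        (fun k _ => mul_nonneg (hN i a k) (wordProd_nonneg hN J k b)) (Finset.mem_univ k))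
      rw [List.length_cons, pow_succ, mul_comm]
      exact mul_le_mul (hθN i a k (left_ne_zero_of_mul hk)) (ih k b (right_ne_zero_of_mul hk))
        (by positivity) (hN i a k)
  have hlθ : Real.log θ ≤ 0 := Real.log_nonpos hθ.le hθ1
  have hlβ : 0 ≤ Real.log β := Real.log_nonneg hβ1
  have hld : 0 ≤ Real.log d := Real.log_nonneg hd1
  refine ⟨-Real.log θ + Real.log β + Real.log d, by linarith, fun J => ?_⟩
  have hJ0 : (0 : ℝ) ≤ J.length := Nat.cast_nonneg _
  have k1 := mul_nonneg hJ0 hlβ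
  have k2 := mul_nonneg hJ0 hld
  have k3 := mul_nonneg hJ0 (neg_nonneg.2 hlθ)
  rcases eq_or_ne (entrySum (wordProd N J)) 0 with h0 | h0
  · rw [h0, Real.log_zero, abs_zero]
    linarith
  have hpos : 0 < entrySum (wordProd N J) :=
    lt_of_le_of_ne (entrySum_nonneg (wordProd_nonneg hN J)) h0.symm
  rw [abs_le]
  constructor
  · obtain ⟨a, -, ha⟩ := Finset.exists_ne_zero_of_sum_ne_zero h0
    obtain ⟨b, -, hb⟩ := Finset.exists_ne_zero_of_sum_ne_zero ha
    have h1 := (hlower J a b hb).trans (le_entrySum (wordProd_nonneg hN J) a b)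
    have h2 := Real.log_le_log (by positivity) h1
    rw [Real.log_pow] at h2
    linarith
  · have h2 := Real.log_le_log hpos (hupper J)
    rw [Real.log_mul (by positivity) (by positivity), Real.log_pow] at h2
    linarith

end WordProd

/-! ### From the subshift to weights on words -/

section Transfer

variable {m d : ℕ} {A : Matrix (Fin m) (Fin m) ℤ}

open Classical in
/-- The norm of the product along a word, set to zero on the words that are not admissible. -/
noncomputable def wordNorm (A : Matrix (Fin m) (Fin m) ℤ)
    (N : Fin m → Matrix (Fin d) (Fin d) ℝ) (J : List (Fin m)) : ℝ :=
  if Admissible A J then entrySum (wordProd N J) else 0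

theorem admissible_append_append {I K J : List (Fin m)} {i j : Fin m}
    (hI : Admissible A (I ++ [i])) (hJ : Admissible A (j :: J))
    (hK : Admissible A (i :: (K ++ [j]))) :
    Admissible A ((I ++ [i]) ++ (K ++ (j :: J))) := by
  have h1 : Admissible A (i :: (K ++ (j :: J))) := by
    have : i :: (K ++ (j :: J)) = (i :: K) ++ j :: J := rfl
    rw [Admissible, this, List.isChain_split]
    exact ⟨hK, hJ⟩
  rw [Admissible, List.append_assoc, List.singleton_append, List.isChain_split]
  exact ⟨hI, h1⟩

/-- By (H2), the norms of the products joined through all admissible connecting words add up to at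
least `δ ‖M_I‖ ‖M_J‖`; these words are bounded in number, so one of them carries a fixed proportion.
-/
theorem wordNorm_quasiMultiplicative (hm : 2 ≤ m) (hd : 1 ≤ d)
    {N : Fin m → Matrix (Fin d) (Fin d) ℝ} (hN : ∀ i a b, 0 ≤ N i a b)
    (H2 : IrreducibleAlong A N) : QuasiMultiplicative (wordNorm A N) := by
  classical
  obtain ⟨r, hr, hirr⟩ := H2
  have : NeZero m := ⟨by omega⟩
  have : NeZero d := ⟨by omega⟩
  have hnn : ∀ J, 0 ≤ wordNorm A N J := fun J => by
    unfold wordNorm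
    split_ifs
    · exact entrySum_nonneg (wordProd_nonneg hN J)
    · exact le_rfl
  refine ⟨hnn, fun I J => ?_, ?_, ?_⟩
  · by_cases h : Admissible A (I ++ J)
    · have h1 : Admissible A I := List.IsChain.left_of_append h
      have h2 : Admissible A J := List.IsChain.right_of_append h
      simp only [wordNorm, h, h1, h2, if_true, wordProd_append]
      exact entrySum_mul_le (wordProd_nonneg hN I) (wordProd_nonneg hN J)
    · rw [wordNorm, if_neg h]
      exact mul_nonneg (hnn I) (hnn J)
  · set S : Fin m → Fin m → Matrix (Fin d) (Fin d) ℝ := fun i j =>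
      ∑ k ∈ Finset.Icc 1 r,
        ∑ K ∈ (admissibleWords A k).filter (fun K => Admissible A (i :: (K ++ [j]))),
          wordProd N K with hS
    obtain ⟨δ, hδ0, hδS⟩ : ∃ δ : ℝ, 0 < δ ∧ ∀ i j a b, δ ≤ S i j a b := by
      obtain ⟨p, hp⟩ := Finite.exists_min
        fun p : Fin m × Fin m × Fin d × Fin d => S p.1 p.2.1 p.2.2.1 p.2.2.2
      exact ⟨_, hirr p.1 p.2.1 p.2.2.1 p.2.2.2, fun i j a b => hp (i, j, a, b)⟩
    set T : ℕ := ∑ k ∈ Finset.Icc 1 r, (words (Fin m) k).card with hT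
    have hT0 : 0 < T := by
      refine Finset.sum_pos (fun k _ => Finset.card_pos.2 ?_) ⟨1, by simp; omega⟩
      exact ⟨List.replicate k 0, by simp [mem_words]⟩
    have hT0' : (0 : ℝ) < T := by exact_mod_cast hT0
    refine ⟨r, δ / T, div_pos hδ0 hT0', fun I J hI hJ => ?_⟩
    by_cases hadm : Admissible A I ∧ Admissible A J
    swap
    -- If `I` or `J` is inadmissible the left side is `0` and any short word serves.
    · refine ⟨[0], by simp, by simpa using Nat.succ_le_of_lt hr, ?_⟩
      have h0 : wordNorm A N I = 0 ∨ wordNorm A N J = 0 := by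
        unfold wordNorm
        rcases not_and_or.1 hadm with h | h <;> simp [h]
      rcases h0 with h | h <;> simp [h, hnn]
    obtain ⟨hAI, hAJ⟩ := hadm
    obtain ⟨I', i, rfl⟩ := (List.eq_nil_or_concat' I).resolve_left hI
    obtain ⟨j, J', rfl⟩ := List.exists_cons_of_ne_nil hJ
    set s : Finset (Σ _ : ℕ, List (Fin m)) := (Finset.Icc 1 r).sigma fun k =>
      (admissibleWords A k).filter (fun K => Admissible A (i :: (K ++ [j]))) with hs
    have hSs : S i j = ∑ x ∈ s, wordProd N x.2 := by
      rw [hs, Finset.sum_sigma]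
    have hsne : s.Nonempty := by
      rw [Finset.nonempty_iff_ne_empty]
      intro h
      have := hirr i j 0 0
      change 0 < S i j 0 0 at this
      rw [hSs, h] at this
      simp at this
    have hscard : s.card ≤ T := by
      rw [hs, Finset.card_sigma]
      refine Finset.sum_le_sum fun k _ => Finset.card_le_card fun K hK => ?_
      rw [Finset.mem_filter, mem_admissibleWords] at hK
      exact mem_words.2 hK.1.1
    set nI := entrySum (wordProd N (I' ++ [i]))
    set nJ := entrySum (wordProd N (j :: J'))
    have hnI : 0 ≤ nI := entrySum_nonneg (wordProd_nonneg hN _)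
    have hnJ : 0 ≤ nJ := entrySum_nonneg (wordProd_nonneg hN _)
    have htotal : δ * nI * nJ ≤
        ∑ x ∈ s, entrySum (wordProd N ((I' ++ [i]) ++ (x.2 ++ (j :: J')))) := by
      have := le_entrySum_mul_mul (wordProd_nonneg hN (I' ++ [i]))
        (wordProd_nonneg hN (j :: J')) (hδS i j)
      refine this.trans (le_of_eq ?_)
      rw [hSs, Finset.sum_mul, Finset.mul_sum, entrySum_sum]
      simp only [wordProd_append]
    obtain ⟨x, hx, hle⟩ := Finset.exists_le_of_sum_le (s := s)
      (f := fun _ => δ * nI * nJ / s.card)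
      (g := fun x => entrySum (wordProd N ((I' ++ [i]) ++ (x.2 ++ (j :: J'))))) hsne (by
        have hc : (s.card : ℝ) ≠ 0 := by exact_mod_cast hsne.card_pos.ne'
        rw [Finset.sum_const, nsmul_eq_mul, mul_div_cancel₀ _ hc]
        exact htotal)
    rw [hs, Finset.mem_sigma, Finset.mem_filter, mem_admissibleWords, Finset.mem_Icc] at hx
    obtain ⟨⟨hx1, hxr⟩, ⟨hxl, -⟩, hxA⟩ := hx
    refine ⟨x.2, ?_, by omega, ?_⟩
    · intro h
      rw [h] at hxl
      simp at hxl
      omega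
    · rw [wordNorm, wordNorm, wordNorm, if_pos hAI, if_pos hAJ,
        if_pos (admissible_append_append hAI hAJ hxA)]
      refine le_trans ?_ hle
      have hc : (0 : ℝ) < s.card := by exact_mod_cast hsne.card_pos
      have hcT : (s.card : ℝ) ≤ T := by exact_mod_cast hscard
      calc δ / T * nI * nJ = δ * nI * nJ / T := by ring
        _ ≤ δ * nI * nJ / s.card := by gcongr
  · have h := (hirr 0 0 0 0).ne'
    rw [Matrix.sum_apply] at h
    obtain ⟨k, hk, h⟩ := Finset.exists_ne_zero_of_sum_ne_zero h
    rw [Matrix.sum_apply] at h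
    obtain ⟨K, hK, h⟩ := Finset.exists_ne_zero_of_sum_ne_zero h
    rw [Finset.mem_filter, mem_admissibleWords] at hK
    rw [Finset.mem_Icc] at hk
    refine ⟨K, ?_, ?_⟩
    · rintro rfl
      have := hK.1.1
      simp at this
      omega
    · rw [wordNorm, if_pos hK.1.2]
      exact (lt_of_le_of_ne (wordProd_nonneg hN K 0 0) (Ne.symm h)).trans_le
        (le_entrySum (wordProd_nonneg hN K) 0 0)

theorem exists_subshift_apply_zero (hsucc : ∀ i, ∃ j, A i j = 1) (i : Fin m) :
    ∃ x : Subshift A, x.1 0 = i := by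
  choose f hf using hsucc
  refine ⟨⟨fun n => f^[n] i, fun n => ?_⟩, rfl⟩
  change A (f^[n] i) (f^[n + 1] i) = 1
  rw [Function.iterate_succ_apply']
  exact hf _

theorem cylinder_cons_nonempty (hsucc : ∀ i, ∃ j, A i j = 1) (J : List (Fin m)) (i : Fin m)
    (h : Admissible A (i :: J)) : (cylinder A (i :: J)).Nonempty := by
  induction J generalizing i with
  | nil =>
    obtain ⟨x, hx⟩ := exists_subshift_apply_zero hsucc i
    refine ⟨x, fun k => ?_⟩
    have : k = ⟨0, by simp⟩ := by
      ext
      simp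
    subst this
    simpa using hx
  | cons j J ih =>
    rw [Admissible, List.isChain_cons_cons] at h
    obtain ⟨x, hx⟩ := ih j h.2
    have hx0 : x.1 0 = j := by simpa using hx ⟨0, by simp⟩
    refine ⟨⟨fun n => Nat.casesOn n i x.1, fun n => ?_⟩, fun k => ?_⟩
    · cases n with
      | zero =>
        change A i (x.1 0) = 1
        rw [hx0]
        exact h.1
      | succ n => exact x.2 n
    · obtain ⟨k, hk⟩ := k
      cases k with
      | zero => rfl
      | succ k => exact hx ⟨k, by simpa using hk⟩

/-- A zero row of `A` would remain zero in every positive power. -/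
theorem exists_succ_of_isPrimitive (hA01 : ∀ i j, A i j = 0 ∨ A i j = 1)
    (hA : A.IsPrimitive) (i : Fin m) : ∃ j, A i j = 1 := by
  by_contra! hne
  have h0 : ∀ j, A i j = 0 := fun j => (hA01 i j).resolve_right (hne j)
  obtain ⟨k, hk, hpos⟩ := hA.exists_pos_pow
  have h1 := hpos i i
  obtain ⟨k, rfl⟩ : ∃ l, k = l + 1 := ⟨k - 1, by omega⟩
  rw [pow_succ', Matrix.mul_apply] at h1
  simp [h0] at h1

theorem orbitProd_eq_wordProd {M : Subshift A → Matrix (Fin d) (Fin d) ℝ}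
    {N : Fin m → Matrix (Fin d) (Fin d) ℝ} (H1 : ∀ x : Subshift A, M x = N (x.1 0))
    {J : List (Fin m)} {x : Subshift A} (hx : x ∈ cylinder A J) :
    orbitProd M J.length x = wordProd N J := by
  have hshift : ∀ k, (Subshift.shift^[k] x).1 0 = x.1 k := by
    have : ∀ (k n : ℕ) (x : Subshift A), (Subshift.shift^[k] x).1 n = x.1 (n + k) := by
      intro k
      induction k with
      | zero => intros; rfl
      | succ k ih =>
        intro n x
        rw [Function.iterate_succ_apply, ih]
        rfl
    intro k
    rw [this, zero_add]
  rw [orbitProd, wordProd]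
  congr 1
  refine List.ext_getElem (by simp) fun k h1 h2 => ?_
  have hk : k < J.length := by simpa using h2
  have := hx ⟨k, hk⟩
  simp only [List.getElem_map, List.getElem_range, H1, hshift]
  rw [this]
  rfl

theorem sum_admissibleWords (N : Fin m → Matrix (Fin d) (Fin d) ℝ) {q : ℝ} (hq : 0 < q) (n : ℕ) :
    ∑ J ∈ admissibleWords A n, entrySum (wordProd N J) ^ q =
      totalWeight (fun J => wordNorm A N J ^ q) n := by
  classical
  have h1 : admissibleWords A n = (words (Fin m) n).filter (Admissible A) := by
    ext J
    rw [mem_admissibleWords, Finset.mem_filter, mem_words]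
  rw [h1, Finset.sum_filter, totalWeight]
  refine Finset.sum_congr rfl fun J _ => ?_
  rw [wordNorm]
  split_ifs
  · rfl
  · exact (Real.zero_rpow hq.ne').symm

/-- On a cylinder the product is constant, so the supremum is its value. Non-emptiness of the
cylinder matters: a real supremum over an empty type is `0`. -/
theorem partitionSum_eq [NeZero m] (hsucc : ∀ i, ∃ j, A i j = 1)
    {M : Subshift A → Matrix (Fin d) (Fin d) ℝ}
    {N : Fin m → Matrix (Fin d) (Fin d) ℝ} (H1 : ∀ x : Subshift A, M x = N (x.1 0))
    (q : ℝ) (n : ℕ) :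
    partitionSum M q n = ∑ J ∈ admissibleWords A n, entrySum (wordProd N J) ^ q := by
  refine Finset.sum_congr rfl fun J hJ => ?_
  rw [mem_admissibleWords] at hJ
  have hne : (cylinder A J).Nonempty := by
    rcases J with _ | ⟨i, J⟩
    · obtain ⟨x, -⟩ := exists_subshift_apply_zero hsucc 0
      exact ⟨x, fun k => absurd k.2 (by simp)⟩
    · exact cylinder_cons_nonempty hsucc J i hJ.2
  have := hne.to_subtype
  rw [← hJ.1]
  have h1 : ∀ x : cylinder A J, entrySum (orbitProd M J.length x) ^ q =
      entrySum (wordProd N J) ^ q := fun x => by rw [orbitProd_eq_wordProd H1 x.2]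
  simp only [h1, ciSup_const]

end Transfer

theorem theorem3p3 {m d : ℕ} (hm : 2 ≤ m) (hd : 1 ≤ d)
    (A : Matrix (Fin m) (Fin m) ℤ) (hA01 : ∀ i j, A i j = 0 ∨ A i j = 1)
    (hA : A.IsPrimitive)
    (M : Subshift A → Matrix (Fin d) (Fin d) ℝ) (hM : ∀ x a b, 0 ≤ M x a b)
    (N : Fin m → Matrix (Fin d) (Fin d) ℝ)
    (H1 : ∀ x : Subshift A, M x = N (x.1 0))
    (H2 : IrreducibleAlong A N) :
    ∀ q : ℝ, 0 < q →
      (∀ n : ℕ, 1 ≤ n → 0 < partitionSum M q n) ∧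
      Tendsto (fun n : ℕ => (1 / (n : ℝ)) * Real.log (partitionSum M q n))
        atTop (𝓝 (pressure M q)) ∧
      Tendsto (fun n : ℕ => (1 / (n : ℝ)) *
          Real.log (∑ J ∈ admissibleWords A n, entrySum (wordProd N J) ^ q))
        atTop (𝓝 (pressure M q)) ∧
      DifferentiableAt ℝ (pressure M) q := by
  have : NeZero m := ⟨by omega⟩
  have hsucc := exists_succ_of_isPrimitive hA01 hA
  -- Every symbol begins some point of the subshift, so non-negativity passes from `M` to all the `N
  -- i`.
  have hN : ∀ i a b, 0 ≤ N i a b := by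
    intro i a b
    obtain ⟨x, rfl⟩ := exists_subshift_apply_zero hsucc i
    rw [← H1]
    exact hM x a b
  have hφ := wordNorm_quasiMultiplicative hm hd hN H2
  obtain ⟨κ, hκ0, hκ⟩ := exists_abs_log_entrySum_le hd hN
  have hκ' : ∀ J, |Real.log (wordNorm A N J)| ≤ κ * (J.length + 1) := by
    intro J
    unfold wordNorm
    split_ifs
    · exact hκ J
    · rw [Real.log_zero, abs_zero]
      positivity
  obtain ⟨P, hP⟩ := hφ.exists_differentiable_growth_rate hκ0 hκ'
  have hpart : ∀ q, 0 < q → ∀ n, partitionSum M q n =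
      totalWeight (fun J => wordNorm A N J ^ q) n := fun q hq n => by
    rw [partitionSum_eq hsucc H1, sum_admissibleWords N hq]
  have hpressure : ∀ q, 0 < q → pressure M q = P q := by
    intro q hq
    refine Tendsto.limUnder_eq ?_
    simp only [hpart q hq]
    exact (hP q hq).1
  intro q hq
  refine ⟨fun n _ => ?_, ?_, ?_, ?_⟩
  · rw [hpart q hq]
    exact (hφ.rpow hq).totalWeight_pos n
  · simp only [hpart q hq, hpressure q hq]
    exact (hP q hq).1
  · simp only [sum_admissibleWords N hq, hpressure q hq]
    exact (hP q hq).1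
  -- The pressure is identified with `P` only on positive exponents, which form a neighbourhood of
  -- `q`.
  · refine (hP q hq).2.congr_of_eventuallyEq ?_
    filter_upwards [lt_mem_nhds hq] with q' hq'
    exact hpressure q' hq'
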